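/- Let $G_1,G_2,G_3,G_4$ be finitely presented groups, and let $\phi\colon G_1\times G_2\times G_3\times G_4\to\mathbb{Z}^2$ be a homomorphism whose restriction to each factor $G_i$ is surjective. Then $K:=\ker\phi$ is finitely presented. Moreover, if $f$ is the Dehn function of $G_1\times G_2\times G_3\times G_4$ with respect to any finite presentation, $\delta_K$ is the Dehn function of $K$ with respect to any finite presentation, and $\overline f$ is the superadditive closure of $f$, then $$f(n)\preccurlyeq \delta_K(n)\preccurlyeq \overline f(n)\cdot\log(n).$$ Here, for a finite presentation $\langle X\mid R\rangle$, a word is a (not necessarily reduced) finite sequence of elements of $X\sqcup X^{-1}$. The area of a word $w$ representing the trivial element is the least $l$ such that $w=\prod_{i=1}^{l}w_ir_iw_i^{-1}$ in the free group $F(X)$ with $w_i\in F(X)$ and $r_i\in R^{\pm1}$, and the Dehn function at $n\in\mathbb{N}$ is the maximal area of a word of length at most $n$ that represents the trivial element. The superadditive closure $\overline f$ is the smallest function $\overline f\colon\mathbb{N}\to\mathbb{R}$ with $\overline f\geq f$ and $\overline f(n+m)\geq\overline f(n)+\overline f(m)$ for all $n,m$. For functions $g,h\colon\mathbb{R}_{>0}\to\mathbb{R}$,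 the relation $g\preccurlyeq h$ means that there is a constant $C>0$ with $g(x)\leq C\,h(Cx+C)+Cx+C$ for all $x>0$; functions $g$ on $\mathbb{N}$ are extended to $\mathbb{R}_{>0}$ by $x\mapsto g(\lfloor x\rfloor)$, and the function on the right above is $x\mapsto\overline f(\lfloor x\rfloor)\log x$. -/

import Mathlib

namespace GroupDehn

/-- A *filling* of an element `g` of the free group on `α` with respect to a set `R` of relators:
a finite sequence of conjugates `u * r * u⁻¹` with `u` in the free group and `r ∈ R ∪ R⁻¹`,
whose product in the free group is `g`. Its length is the number of factors. -/
def IsFilling {α : Type*} (R : Set (FreeGroup α)) (g : FreeGroup α)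
    (L : List (FreeGroup α)) : Prop :=
  (∀ x ∈ L, ∃ u r : FreeGroup α, (r ∈ R ∨ r⁻¹ ∈ R) ∧ x = u * r * u⁻¹) ∧ L.prod = g

/-- The area of `g` with respect to the relators `R`: the minimal length of a filling of `g`
(meaningful when `g` lies in the normal closure of `R`, see `exists_isFilling`). -/
noncomputable def area {α : Type*} (R : Set (FreeGroup α)) (g : FreeGroup α) : ℕ :=
  sInf {l : ℕ | ∃ L : List (FreeGroup α), IsFilling R g L ∧ L.length = l}

/-- The areas of all words `w` in the generators and their inverses (not necessarily reduced),
of length at most `n`, that represent the trivial element of `⟨α ∣ R⟩`. -/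
def areasOfNullWords {α : Type*} (R : Set (FreeGroup α)) (n : ℕ) : Set ℕ :=
  {a : ℕ | ∃ w : List (α × Bool), w.length ≤ n ∧
    PresentedGroup.mk R (FreeGroup.mk w) = 1 ∧ a = area R (FreeGroup.mk w)}

/-- The Dehn function of the finite presentation `⟨α ∣ R⟩`: the maximal area of a word of length
at most `n` that represents the trivial element (the maximum exists, see
`isGreatest_dehnFunction`). -/
noncomputable def dehnFunction {α : Type*} (R : Set (FreeGroup α)) (n : ℕ) : ℕ :=
  sSup (areasOfNullWords R n)

/-- `⟨α ∣ R⟩` is a finite presentation of the group `G`. -/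
def IsFinitePresentationOf {α : Type*} (R : Set (FreeGroup α)) (G : Type*) [Group G] : Prop :=
  Finite α ∧ R.Finite ∧ Nonempty (PresentedGroup R ≃* G)

/-- A function on `ℕ` is superadditive. -/
def Superadditive (f : ℕ → ℝ) : Prop :=
  ∀ n m : ℕ, f n + f m ≤ f (n + m)

/-- The superadditive closure of `f`: the smallest superadditive function that is at least `f`,
given pointwise as the infimum of all of these functions
(for `f 0 ≤ 0` it is indeed the least one, see `isLeast_superadditiveClosure`). -/
noncomputable def superadditiveClosure (f : ℕ → ℝ) (n : ℕ) : ℝ :=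
  sInf {y : ℝ | ∃ g : ℕ → ℝ, Superadditive g ∧ (∀ k, f k ≤ g k) ∧ y = g n}

/-- The asymptotic preorder `f ≼ g` on (increasing) functions on the positive reals. -/
def AsympLE (f g : ℝ → ℝ) : Prop :=
  ∃ C : ℝ, 0 < C ∧ ∀ x : ℝ, 0 < x → f x ≤ C * g (C * x + C) + C * x + C

theorem exists_isFilling {α : Type*} (R : Set (FreeGroup α)) (g : FreeGroup α) :
    (∃ L, IsFilling R g L) ↔ PresentedGroup.mk R g = 1 := by
  rw [PresentedGroup.mk_eq_one_iff]
  constructor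
  · rintro ⟨L, hL, rfl⟩
    refine Subgroup.list_prod_mem _ fun x hx => ?_
    obtain ⟨u, r, hr, rfl⟩ := hL x hx
    refine Subgroup.normalClosure_normal.conj_mem _ ?_ u
    rcases hr with hr | hr
    · exact Subgroup.subset_normalClosure hr
    · simpa using Subgroup.inv_mem _ (Subgroup.subset_normalClosure hr)
  · intro hg
    induction hg using Subgroup.closure_induction with
    | mem x hx =>
      obtain ⟨r, hr, hrx⟩ := Group.mem_conjugatesOfSet_iff.1 hx
      obtain ⟨u, rfl⟩ := isConj_iff.1 hrx
      exact ⟨[u * r * u⁻¹], by simpa using ⟨u, r, Or.inl hr, rfl⟩, by simp⟩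
    | one => exact ⟨[], by simp, by simp⟩
    | mul x y _ _ hx hy =>
      obtain ⟨L, hL, rfl⟩ := hx
      obtain ⟨M, hM, rfl⟩ := hy
      refine ⟨L ++ M, fun z hz => ?_, by simp⟩
      rcases List.mem_append.1 hz with hz | hz
      · exact hL z hz
      · exact hM z hz
    | inv x _ hx =>
      obtain ⟨L, hL, rfl⟩ := hx
      refine ⟨(L.map fun y => y⁻¹).reverse, fun z hz => ?_, (List.prod_inv_reverse L).symm⟩
      obtain ⟨y, hy, rfl⟩ := List.mem_map.1 (List.mem_reverse.1 hz)
      obtain ⟨u, r, hr, rfl⟩ := hL y hy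
      exact ⟨u, r⁻¹, by simpa using hr.symm, by group⟩

theorem isGreatest_dehnFunction {α : Type*} [Finite α] (R : Set (FreeGroup α)) (n : ℕ) :
    IsGreatest (areasOfNullWords R n) (dehnFunction R n) := by
  have hfin : (areasOfNullWords R n).Finite := by
    refine ((List.finite_length_le (α × Bool) n).image
      fun w => area R (FreeGroup.mk w)).subset ?_
    rintro a ⟨w, hw, -, rfl⟩
    exact ⟨w, hw, rfl⟩
  have hne : (areasOfNullWords R n).Nonempty :=
    ⟨_, [], by simp, by simp [← FreeGroup.one_eq_mk], rfl⟩
  exact ⟨Nat.sSup_mem hne hfin.bddAbove, fun a ha => le_csSup hfin.bddAbove ha⟩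

theorem dehnFunction_zero {α : Type*} (R : Set (FreeGroup α)) : dehnFunction R 0 = 0 := by
  have harea : area R 1 = 0 := Nat.sInf_eq_zero.2 (Or.inl ⟨[], ⟨by simp, by simp⟩, rfl⟩)
  have : areasOfNullWords R 0 ⊆ {0} := by
    rintro a ⟨w, hw, -, rfl⟩
    obtain rfl : w = [] := by simpa using hw
    simpa [← FreeGroup.one_eq_mk] using harea
  rcases Set.subset_singleton_iff_eq.1 this with h | h <;> simp [dehnFunction, h]

theorem isLeast_superadditiveClosure (f : ℕ → ℝ) (h0 : f 0 ≤ 0) :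
    IsLeast {g : ℕ → ℝ | Superadditive g ∧ ∀ k, f k ≤ g k} (superadditiveClosure f) := by
  have hbdd : ∀ n, BddBelow
      {y : ℝ | ∃ g : ℕ → ℝ, Superadditive g ∧ (∀ k, f k ≤ g k) ∧ y = g n} := by
    rintro n
    refine ⟨f n, ?_⟩
    rintro y ⟨g, -, hg, rfl⟩
    exact hg n
  have hne : ∃ g : ℕ → ℝ, Superadditive g ∧ ∀ k, f k ≤ g k := by
    refine ⟨fun n => n * ∑ k ∈ Finset.range (n + 1), |f k|, fun n m => ?_, fun k => ?_⟩
    · have h1 : ∀ a b : ℕ, a ≤ b →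
          ∑ k ∈ Finset.range (a + 1), |f k| ≤ ∑ k ∈ Finset.range (b + 1), |f k| := fun a b hab =>
        Finset.sum_le_sum_of_subset_of_nonneg (Finset.range_subset_range.2 (by omega))
          fun _ _ _ => abs_nonneg _
      have hn := mul_le_mul_of_nonneg_left (h1 n (n + m) (by omega)) (Nat.cast_nonneg (α := ℝ) n)
      have hm := mul_le_mul_of_nonneg_left (h1 m (n + m) (by omega)) (Nat.cast_nonneg (α := ℝ) m)
      push_cast
      linarith
    · rcases Nat.eq_zero_or_pos k with rfl | hk
      · simpa using h0
      · have h1 : |f k| ≤ ∑ j ∈ Finset.range (k + 1), |f j| :=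
          Finset.single_le_sum (f := fun j => |f j|) (fun _ _ => abs_nonneg _)
            (Finset.mem_range.2 (by omega))
        have h2 : (1 : ℝ) ≤ k := by exact_mod_cast hk
        have h3 := abs_nonneg (f k)
        have h4 := le_abs_self (f k)
        nlinarith
  obtain ⟨g₀, hg₀, hfg₀⟩ := hne
  refine ⟨⟨fun n m => ?_, fun k => ?_⟩, ?_⟩
  · refine le_csInf ⟨_, g₀, hg₀, hfg₀, rfl⟩ ?_
    rintro y ⟨g, hg, hfg, rfl⟩
    exact (add_le_add (csInf_le (hbdd n) ⟨g, hg, hfg, rfl⟩)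
      (csInf_le (hbdd m) ⟨g, hg, hfg, rfl⟩)).trans (hg n m)
  · refine le_csInf ⟨_, g₀, hg₀, hfg₀, rfl⟩ ?_
    rintro y ⟨g, -, hfg, rfl⟩
    exact hfg k
  · rintro g ⟨hg, hfg⟩ n
    exact csInf_le (hbdd n) ⟨g, hg, hfg, rfl⟩

end GroupDehn

/-! The argument yields equivalence of the two Dehn functions; the superadditive closure and the
logarithm only weaken the upper bound. All estimates carry a quadratic error, which is absorbed
because both Dehn functions are at least quadratic (`dominated_sq`, by mapping to the Heisenberg
group).

Give each factor generators `x₀, x₁` over the standard basis of `ℤ²` and further generators over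
zero, and let `F` be the free group on them. Relators of the factors then have exponent zero in `x₀`
and `x₁`. The kernel of `F⁴ → ℤ²` is generated by the quotients of `x_r` in factor `i` by `x_r` in
factor `j`, together with the remaining generators. The section `sect i k l` lifts factor `i` to
this kernel, compensating `x₀` in factor `k` and `x₁` in factor `l`. Since `x₀` and `x₁` are
compensated in different places, the sections of factors `i` and `j` with the same `k, l` commute;
this uses four distinct factors.

The heart is a quadratic bound for reaching a normal form. On elements of exponent zero all sections
of a factor agree at quadratic cost (`near_sect_sect`), so for each commutator the most convenient
section may be used. Hence kernel elements supported in complementary pairs of factors commute at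
quadratic cost (`near_cross_comm`), products of normal forms can be renormalised at quadratic cost
(`near_normalForm_mul`), and cutting a word in halves gives a recursion with quadratic solution
(`near_normalForm`).

For a word trivial in `K`, the normal form is a product of sections of words trivial in the `G i`,
and these are filled inside the `G i`. So `δ_K` is at most a quadratic term plus the sum of the Dehn
functions of the factors, and the same holds for the product. Conversely each factor is a retract of
both groups (`dominated_of_retract`), so both Dehn functions dominate each summand. -/

namespace GroupDehn

/-! ### Counting relators between elements of a free group -/

section Near

variable {α β : Type*} {S : Set (FreeGroup α)} {T : Set (FreeGroup β)}

/-- `Near S n g h` says that `g` can be transformed into `h` by applying at most `n` relators. -/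
def Near (S : Set (FreeGroup α)) (n : ℕ) (g h : FreeGroup α) : Prop :=
  ∃ L, IsFilling S (g * h⁻¹) L ∧ L.length ≤ n

theorem IsFilling.mul {g h : FreeGroup α} {L M : List (FreeGroup α)} (hL : IsFilling S g L)
    (hM : IsFilling S h M) : IsFilling S (g * h) (L ++ M) := by
  refine ⟨fun x hx => ?_, by simp [hL.2, hM.2]⟩
  rcases List.mem_append.1 hx with hx | hx
  · exact hL.1 x hx
  · exact hM.1 x hx

theorem IsFilling.conj {g : FreeGroup α} {L : List (FreeGroup α)} (hL : IsFilling S g L)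
    (u : FreeGroup α) : IsFilling S (u * g * u⁻¹) (L.map (MulAut.conj u)) := by
  refine ⟨fun x hx => ?_, by rw [← map_list_prod, hL.2]; simp⟩
  obtain ⟨y, hy, rfl⟩ := List.mem_map.1 hx
  obtain ⟨v, r, hr, rfl⟩ := hL.1 y hy
  exact ⟨u * v, r, hr, by simp [mul_assoc]⟩

theorem IsFilling.inv {g : FreeGroup α} {L : List (FreeGroup α)} (hL : IsFilling S g L) :
    IsFilling S g⁻¹ (L.map fun y => y⁻¹).reverse := by
  refine ⟨fun z hz => ?_, ?_⟩
  · obtain ⟨y, hy, rfl⟩ := List.mem_map.1 (List.mem_reverse.1 hz)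
    obtain ⟨u, r, hr, rfl⟩ := hL.1 y hy
    exact ⟨u, r⁻¹, by simpa using hr.symm, by group⟩
  · rw [← hL.2]; exact (List.prod_inv_reverse L).symm

theorem Near.mono {n m : ℕ} {g h : FreeGroup α} (H : Near S n g h) (hnm : n ≤ m) :
    Near S m g h := by
  obtain ⟨L, hL, hn⟩ := H
  exact ⟨L, hL, hn.trans hnm⟩

theorem Near.refl (g : FreeGroup α) : Near S 0 g g :=
  ⟨[], ⟨by simp, by simp⟩, by simp⟩

theorem near_of_eq {g h : FreeGroup α} (H : g = h) (n : ℕ) : Near S n g h :=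
  H ▸ (Near.refl g).mono (Nat.zero_le _)

theorem Near.symm {n : ℕ} {g h : FreeGroup α} (H : Near S n g h) : Near S n h g := by
  obtain ⟨L, hL, hn⟩ := H
  exact ⟨_, by simpa using hL.inv, by simpa using hn⟩

theorem Near.trans {n m : ℕ} {g h k : FreeGroup α} (H : Near S n g h) (H' : Near S m h k) :
    Near S (n + m) g k := by
  obtain ⟨L, hL, hn⟩ := H
  obtain ⟨M, hM, hm⟩ := H'
  exact ⟨_, by simpa using hL.mul hM, by simp; omega⟩

theorem Near.mul_left {n : ℕ} {g h : FreeGroup α} (H : Near S n g h) (u : FreeGroup α) :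
    Near S n (u * g) (u * h) := by
  obtain ⟨L, hL, hn⟩ := H
  exact ⟨_, by simpa [mul_assoc] using hL.conj u, by simpa using hn⟩

theorem Near.mul_right {n : ℕ} {g h : FreeGroup α} (H : Near S n g h) (u : FreeGroup α) :
    Near S n (g * u) (h * u) := by
  obtain ⟨L, hL, hn⟩ := H
  exact ⟨L, by simpa [mul_assoc] using hL, hn⟩

theorem Near.mul {n m : ℕ} {g h g' h' : FreeGroup α} (H : Near S n g h) (H' : Near S m g' h') :
    Near S (n + m) (g * g') (h * h') :=
  (H.mul_right g').trans (H'.mul_left h)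

theorem Near.inv {n : ℕ} {g h : FreeGroup α} (H : Near S n g h) : Near S n g⁻¹ h⁻¹ := by
  have := ((H.mul_left g⁻¹).mul_right h⁻¹).symm
  simpa using this

theorem near_of_mem {g h : FreeGroup α} (H : g * h⁻¹ ∈ S) : Near S 1 g h :=
  ⟨[g * h⁻¹], ⟨by simpa using ⟨1, g * h⁻¹, Or.inl H, by simp⟩, by simp⟩, by simp⟩

/-- A homomorphism carries a filling to a product of conjugates of images of relators, each of which
is then refilled. In this way fillings move between the factors, the product and the kernel. -/
theorem Near.map {n c : ℕ} {g h : FreeGroup α} (H : Near S n g h) (f : FreeGroup α →* FreeGroup β)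
    (hf : ∀ r ∈ S, Near T c (f r) 1) : Near T (n * c) (f g) (f h) := by
  obtain ⟨L, ⟨hL, hp⟩, hn⟩ := H
  have key : ∀ L : List (FreeGroup α),
      (∀ x ∈ L, ∃ u r : FreeGroup α, (r ∈ S ∨ r⁻¹ ∈ S) ∧ x = u * r * u⁻¹) →
      Near T (L.length * c) (f L.prod) 1 := by
    intro L
    induction L with
    | nil => intro _; exact near_of_eq (by simp) _
    | cons x L ih =>
      intro hx
      have h1 := ih fun y hy => hx y (List.mem_cons_of_mem _ hy)
      obtain ⟨u, r, hr, rfl⟩ := hx _ List.mem_cons_self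
      have h2 : Near T c (f r) 1 := by
        rcases hr with hr | hr
        · exact hf r hr
        · simpa using (hf _ hr).inv
      have h3 : Near T c (f (u * r * u⁻¹)) 1 := by
        simpa using (h2.mul_left (f u)).mul_right (f u)⁻¹
      have := h3.mul h1
      simp only [List.prod_cons, map_mul, List.length_cons, mul_one] at this ⊢
      exact this.mono (by rw [add_mul]; omega)
  have := ((key L hL).mono (Nat.mul_le_mul_right c hn)).mul_right (f h)
  rw [hp] at this
  simpa using this

theorem Near.zpow {n : ℕ} {g h : FreeGroup α} (H : Near S n g h) (k : ℤ) :
    Near S (k.natAbs * n) (g ^ k) (h ^ k) := by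
  have hpow : ∀ m : ℕ, Near S (m * n) (g ^ m) (h ^ m) := by
    intro m
    induction m with
    | zero => exact near_of_eq (by simp) _
    | succ m ih =>
      rw [pow_succ, pow_succ, add_mul, one_mul]
      exact ih.mul H
  obtain ⟨m, rfl | rfl⟩ := k.eq_nat_or_neg
  · simpa using hpow m
  · simpa using (hpow m).inv

/-- Forgetting the count lets the area estimates double as proofs that the relator sets present the
intended groups. -/
theorem near_one_iff {g : FreeGroup α} :
    (∃ n, Near S n g 1) ↔ g ∈ Subgroup.normalClosure S := by
  rw [← PresentedGroup.mk_eq_one_iff, ← exists_isFilling]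
  constructor
  · rintro ⟨n, L, hL, -⟩
    exact ⟨L, by simpa using hL⟩
  · rintro ⟨L, hL⟩
    exact ⟨_, L, by simpa using hL, le_rfl⟩

theorem Near.area_le {n : ℕ} {g : FreeGroup α} (H : Near S n g 1) : area S g ≤ n := by
  obtain ⟨L, hL, hn⟩ := H
  have hmem : L.length ∈ {l : ℕ | ∃ L, IsFilling S g L ∧ L.length = l} :=
    ⟨L, by simpa using hL, rfl⟩
  exact (Nat.sInf_le hmem).trans hn

/-- Membership matters: without a filling, `area` is the infimum of the empty set, hence `0`. -/
theorem near_area {g : FreeGroup α} (hg : g ∈ Subgroup.normalClosure S) :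
    Near S (area S g) g 1 := by
  rw [← PresentedGroup.mk_eq_one_iff, ← exists_isFilling] at hg
  obtain ⟨L, hL⟩ := hg
  have hne : {l : ℕ | ∃ L, IsFilling S g L ∧ L.length = l}.Nonempty := ⟨_, L, hL, rfl⟩
  obtain ⟨M, hM, hM'⟩ := Nat.sInf_mem hne
  exact ⟨M, by simpa using hM, hM'.le⟩

/-! ### Elements that commute up to a bounded number of relators -/

theorem Near.comm_mul_left {n m : ℕ} {a a' b : FreeGroup α} (H : Near S n (a * b) (b * a))
    (H' : Near S m (a' * b) (b * a')) : Near S (n + m) (a * a' * b) (b * (a * a')) := by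
  have h1 := H'.mul_left a
  have h2 := H.mul_right a'
  rw [← mul_assoc, ← mul_assoc] at h1
  rw [add_comm, ← mul_assoc b]
  exact h1.trans h2

theorem Near.comm_inv_left {n : ℕ} {a b : FreeGroup α} (H : Near S n (a * b) (b * a)) :
    Near S n (a⁻¹ * b) (b * a⁻¹) := by
  have := ((H.mul_left a⁻¹).mul_right a⁻¹).symm
  simpa [mul_assoc] using this

theorem Near.comm_zpow_left {n : ℕ} {a b : FreeGroup α} (H : Near S n (a * b) (b * a)) (k : ℤ) :
    Near S (k.natAbs * n) (a ^ k * b) (b * a ^ k) := by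
  have hpow : ∀ m : ℕ, Near S (m * n) (a ^ m * b) (b * a ^ m) := by
    intro m
    induction m with
    | zero => exact near_of_eq (by simp) _
    | succ m ih =>
      rw [pow_succ, add_mul, one_mul]
      exact ih.comm_mul_left H
  obtain ⟨m, rfl | rfl⟩ := k.eq_nat_or_neg
  · simpa using hpow m
  · simpa using (hpow m).comm_inv_left

theorem Near.comm_zpow {n : ℕ} {a b : FreeGroup α} (H : Near S n (a * b) (b * a)) (k l : ℤ) :
    Near S (k.natAbs * (l.natAbs * n)) (a ^ k * b ^ l) (b ^ l * a ^ k) :=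
  (H.symm.comm_zpow_left l).symm.comm_zpow_left k

/-- Each replacement is made before the exchange and undone after it, so it is paid for twice. -/
theorem Near.comm_congr {n m k : ℕ} {a a' b b' : FreeGroup α} (ha : Near S n a a')
    (hb : Near S m b b') (H : Near S k (a' * b') (b' * a')) :
    Near S (2 * n + 2 * m + k) (a * b) (b * a) :=
  (((ha.mul hb).trans H).trans (hb.symm.mul ha.symm)).mono (by omega)

theorem mk_cons_eq (x : α × Bool) (w : List (α × Bool)) :
    FreeGroup.mk (x :: w) = FreeGroup.mk [x] * FreeGroup.mk w := by
  simp

theorem mk_singleton_false (a : α) : FreeGroup.mk [(a, false)] = (FreeGroup.of a)⁻¹ := rfl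

theorem near_mk_singleton_comm {c : ℕ} {b : FreeGroup β} (f : FreeGroup α →* FreeGroup β)
    (H : ∀ a, Near T c (f (FreeGroup.of a) * b) (b * f (FreeGroup.of a))) (x : α × Bool) :
    Near T c (f (FreeGroup.mk [x]) * b) (b * f (FreeGroup.mk [x])) := by
  obtain ⟨a, _ | _⟩ := x
  · rw [mk_singleton_false, map_inv]
    exact (H a).comm_inv_left
  · exact H a

theorem near_comm_map_left [DecidableEq α] {c : ℕ} {b : FreeGroup β}
    (f : FreeGroup α →* FreeGroup β)
    (H : ∀ a, Near T c (f (FreeGroup.of a) * b) (b * f (FreeGroup.of a))) (u : FreeGroup α) :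
    Near T (u.norm * c) (f u * b) (b * f u) := by
  have key : ∀ w : List (α × Bool),
      Near T (w.length * c) (f (FreeGroup.mk w) * b) (b * f (FreeGroup.mk w)) := by
    intro w
    induction w with
    | nil => exact near_of_eq (by simp [← FreeGroup.one_eq_mk]) _
    | cons x w ih =>
      rw [mk_cons_eq, map_mul, List.length_cons, add_mul, one_mul, add_comm]
      exact (near_mk_singleton_comm f H x).comm_mul_left ih
  simpa [FreeGroup.norm, FreeGroup.mk_toWord] using key u.toWord

theorem near_comm_map {α' : Type*} [DecidableEq α] [DecidableEq α'] {c : ℕ}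
    (f : FreeGroup α →* FreeGroup β) (g : FreeGroup α' →* FreeGroup β)
    (H : ∀ a b, Near T c (f (FreeGroup.of a) * g (FreeGroup.of b))
      (g (FreeGroup.of b) * f (FreeGroup.of a))) (u : FreeGroup α) (v : FreeGroup α') :
    Near T (u.norm * (v.norm * c)) (f u * g v) (g v * f u) :=
  near_comm_map_left f (fun a => (near_comm_map_left g (fun b => (H a b).symm) v).symm) u

/-- If `f` agrees with `g` on the generators up to powers of an element `s` that commutes
with the image of `g`, then the two maps agree everywhere up to powers of `s`,
at quadratic cost. -/
theorem near_twist [DecidableEq α] (f g : FreeGroup α →* FreeGroup β) (s : FreeGroup β)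
    (p : FreeGroup α →* Multiplicative ℤ)
    (hp : ∀ a, (p (FreeGroup.of a)).toAdd.natAbs ≤ 1)
    (hfg : ∀ a, Near T 1 (f (FreeGroup.of a))
      (g (FreeGroup.of a) * s ^ (p (FreeGroup.of a)).toAdd))
    (hs : ∀ a, Near T 1 (g (FreeGroup.of a) * s) (s * g (FreeGroup.of a))) (u : FreeGroup α) :
    Near T (3 * u.norm ^ 2) (f u) (g u * s ^ (p u).toAdd) := by
  have hletter : ∀ x : α × Bool, (p (FreeGroup.mk [x])).toAdd.natAbs ≤ 1 ∧
      Near T 2 (f (FreeGroup.mk [x])) (g (FreeGroup.mk [x]) * s ^ (p (FreeGroup.mk [x])).toAdd) := by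
    rintro ⟨a, _ | _⟩
    · rw [mk_singleton_false]
      refine ⟨by simpa using hp a, ?_⟩
      -- Inversion reverses the order of the two factors; restoring it takes at most one more
      -- relator, hence cost `2` per letter.
      have h1 := (hfg a).inv
      have h2 := ((hs a).comm_zpow (-1) (-(p (FreeGroup.of a)).toAdd)).symm
      have h3 : (-1 : ℤ).natAbs * ((-(p (FreeGroup.of a)).toAdd).natAbs * 1) ≤ 1 := by
        simpa using hp a
      rw [mul_inv_rev, ← zpow_neg, ← zpow_neg_one (g _)] at h1
      have h4 := h1.trans (h2.mono h3)
      rwa [zpow_neg_one, ← map_inv, ← map_inv, ← toAdd_inv, ← map_inv] at h4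
    · exact ⟨hp a, (hfg a).mono (by norm_num)⟩
  have key : ∀ w : List (α × Bool), Near T (3 * w.length ^ 2) (f (FreeGroup.mk w))
      (g (FreeGroup.mk w) * s ^ (p (FreeGroup.mk w)).toAdd) := by
    intro w
    induction w with
    | nil => exact near_of_eq (by simp [← FreeGroup.one_eq_mk]) _
    | cons x w ih =>
      rw [mk_cons_eq, map_mul, map_mul, map_mul]
      have h1 := (hletter x).2.mul ih
      -- The power of `s` contributed by the new letter has exponent at most `1` in absolute value
      -- and moves past the rest of the word at linear cost; `3n² + n + 2 ≤ 3(n + 1)²` closes the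
      -- induction.
      have h2 := (near_comm_map_left g hs (FreeGroup.mk w)).symm.comm_zpow_left
        (p (FreeGroup.mk [x])).toAdd
      have h3 := (h2.mul_left (g (FreeGroup.mk [x]))).mul_right (s ^ (p (FreeGroup.mk w)).toAdd)
      have h4 : (p (FreeGroup.mk [x])).toAdd.natAbs * ((FreeGroup.mk w).norm * 1) ≤ w.length := by
        have := Nat.mul_le_mul (hletter x).1 (FreeGroup.norm_mk_le (L₁ := w))
        simpa using this
      have h5 := h1.trans ((by simpa [mul_assoc, zpow_add] using h3.mono h4 :
        Near T w.length (g (FreeGroup.mk [x]) * s ^ (p (FreeGroup.mk [x])).toAdd *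
          (g (FreeGroup.mk w) * s ^ (p (FreeGroup.mk w)).toAdd))
          (g (FreeGroup.mk [x]) * g (FreeGroup.mk w) *
            s ^ ((p (FreeGroup.mk [x])).toAdd + (p (FreeGroup.mk w)).toAdd))))
      rw [toAdd_mul]
      refine h5.mono ?_
      rw [List.length_cons]
      nlinarith
  simpa [FreeGroup.norm, FreeGroup.mk_toWord] using key u.toWord

end Near

/-! ### Word length under powers and homomorphisms -/

section Norm

variable {α β : Type*} [DecidableEq α] [DecidableEq β]

theorem norm_zpow_le (g : FreeGroup α) (k : ℤ) : (g ^ k).norm ≤ k.natAbs * g.norm := by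
  have hpow : ∀ m : ℕ, (g ^ m).norm ≤ m * g.norm := by
    intro m
    induction m with
    | zero => simp
    | succ m ih =>
      rw [pow_succ, add_mul, one_mul]
      exact (FreeGroup.norm_mul_le _ _).trans (by omega)
  obtain ⟨m, rfl | rfl⟩ := k.eq_nat_or_neg
  · simpa using hpow m
  · simpa using hpow m

theorem norm_map_le (f : FreeGroup α →* FreeGroup β) {c : ℕ}
    (hf : ∀ a, (f (FreeGroup.of a)).norm ≤ c) (g : FreeGroup α) : (f g).norm ≤ c * g.norm := by
  have key : ∀ w : List (α × Bool), (f (FreeGroup.mk w)).norm ≤ c * w.length := by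
    intro w
    induction w with
    | nil => simp [← FreeGroup.one_eq_mk]
    | cons x w ih =>
      rw [mk_cons_eq, map_mul]
      refine (FreeGroup.norm_mul_le _ _).trans ?_
      have : (f (FreeGroup.mk [x])).norm ≤ c := by
        obtain ⟨a, _ | _⟩ := x
        · rw [mk_singleton_false, map_inv, FreeGroup.norm_inv_eq]
          exact hf a
        · exact hf a
      rw [List.length_cons]
      linarith
  simpa [FreeGroup.norm, FreeGroup.mk_toWord] using key g.toWord

theorem natAbs_toAdd_le (p : FreeGroup α →* Multiplicative ℤ) {c : ℕ}
    (hp : ∀ a, (p (FreeGroup.of a)).toAdd.natAbs ≤ c) (g : FreeGroup α) :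
    (p g).toAdd.natAbs ≤ c * g.norm := by
  have key : ∀ w : List (α × Bool), (p (FreeGroup.mk w)).toAdd.natAbs ≤ c * w.length := by
    intro w
    induction w with
    | nil => simp [← FreeGroup.one_eq_mk]
    | cons x w ih =>
      rw [mk_cons_eq, map_mul, toAdd_mul]
      refine (Int.natAbs_add_le _ _).trans ?_
      have : (p (FreeGroup.mk [x])).toAdd.natAbs ≤ c := by
        obtain ⟨a, _ | _⟩ := x
        · rw [mk_singleton_false, map_inv, toAdd_inv, Int.natAbs_neg]
          exact hp a
        · exact hp a
      rw [List.length_cons]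
      linarith
  simpa [FreeGroup.norm, FreeGroup.mk_toWord] using key g.toWord

theorem finite_norm_le [Finite α] (n : ℕ) : {g : FreeGroup α | g.norm ≤ n}.Finite := by
  refine ((List.finite_length_le (α × Bool) n).image FreeGroup.mk).subset ?_
  intro g hg
  exact ⟨g.toWord, hg, FreeGroup.mk_toWord⟩

end Norm


/-! ### Comparison of Dehn functions -/

section Comparison

variable {α β : Type*} {R : Set (FreeGroup α)} {S : Set (FreeGroup β)}

theorem mk_eq_one_iff_mem {g : FreeGroup α} :
    PresentedGroup.mk R g = 1 ↔ g ∈ Subgroup.normalClosure R :=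
  PresentedGroup.mk_eq_one_iff

theorem area_le_dehnFunction [Finite α] [DecidableEq α] {g : FreeGroup α}
    (hg : g ∈ Subgroup.normalClosure R) {n : ℕ} (hn : g.norm ≤ n) : area R g ≤ dehnFunction R n :=
  (isGreatest_dehnFunction R n).2
    ⟨g.toWord, hn, by rwa [FreeGroup.mk_toWord, mk_eq_one_iff_mem], by rw [FreeGroup.mk_toWord]⟩

theorem near_dehnFunction [Finite α] [DecidableEq α] {g : FreeGroup α}
    (hg : g ∈ Subgroup.normalClosure R) {n : ℕ} (hn : g.norm ≤ n) :
    Near R (dehnFunction R n) g 1 :=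
  (near_area hg).mono (area_le_dehnFunction hg hn)

theorem dehnFunction_le [Finite α] [DecidableEq α] {n c : ℕ}
    (H : ∀ g ∈ Subgroup.normalClosure R, g.norm ≤ n → Near R c g 1) : dehnFunction R n ≤ c := by
  obtain ⟨w, hw, hw1, ha⟩ := (isGreatest_dehnFunction R n).1
  rw [ha]
  exact (H _ (mk_eq_one_iff_mem.1 hw1) (FreeGroup.norm_mk_le.trans hw)).area_le

theorem dehnFunction_mono [Finite α] : Monotone (dehnFunction R) := by
  intro n m hnm
  obtain ⟨w, hw, hw1, ha⟩ := (isGreatest_dehnFunction R n).1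
  exact (isGreatest_dehnFunction R m).2 ⟨w, hw.trans hnm, hw1, ha⟩

/-- Domination of functions on `ℕ` up to linear terms. -/
def Dominated (f g : ℕ → ℕ) : Prop := ∃ C, ∀ n, f n ≤ C * g (C * n) + C * n

theorem Dominated.of_le {f g : ℕ → ℕ} (h : ∀ n, f n ≤ g n) : Dominated f g :=
  ⟨1, fun n => by simpa using (h n).trans (by simp)⟩

theorem Dominated.trans {f g h : ℕ → ℕ} (hh : Monotone h) (H : Dominated f g)
    (H' : Dominated g h) : Dominated f h := by
  obtain ⟨C, hC⟩ := H
  obtain ⟨D, hD⟩ := H'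
  refine ⟨C * D + C * D * C + C, fun n => ?_⟩
  have h1 : h (D * (C * n)) ≤ h ((C * D + C * D * C + C) * n) :=
    hh (by nlinarith [Nat.zero_le (C * D * C * n), Nat.zero_le (C * n)])
  calc f n ≤ C * g (C * n) + C * n := hC n
    _ ≤ C * (D * h (D * (C * n)) + D * (C * n)) + C * n := by gcongr; exact hD _
    _ ≤ C * (D * h ((C * D + C * D * C + C) * n) + D * (C * n)) + C * n := by gcongr
    _ ≤ _ := by
      nlinarith [Nat.zero_le (C * D * C * h ((C * D + C * D * C + C) * n)),
        Nat.zero_le (C * h ((C * D + C * D * C + C) * n)), Nat.zero_le (C * D * n)]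

theorem Dominated.add {f f' g : ℕ → ℕ} (hg : Monotone g) (H : Dominated f g)
    (H' : Dominated f' g) : Dominated (fun n => f n + f' n) g := by
  obtain ⟨C, hC⟩ := H
  obtain ⟨D, hD⟩ := H'
  refine ⟨C + D, fun n => ?_⟩
  have h1 : g (C * n) ≤ g ((C + D) * n) := hg (by nlinarith)
  have h2 : g (D * n) ≤ g ((C + D) * n) := hg (by nlinarith)
  have h3 := Nat.mul_le_mul_left C h1
  have h4 := Nat.mul_le_mul_left D h2
  have := hC n
  have := hD n
  simp only [add_mul] at *
  omega

theorem Dominated.const_mul {f g : ℕ → ℕ} (hg : Monotone g) (H : Dominated f g) (k : ℕ) :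
    Dominated (fun n => k * f n) g := by
  induction k with
  | zero => exact ⟨0, fun n => by simp⟩
  | succ k ih =>
    simpa only [add_mul, one_mul] using ih.add hg H

theorem Dominated.comp_mul {f g : ℕ → ℕ} (H : Dominated f g) (hg : Monotone g) (k : ℕ) :
    Dominated (fun n => f (k * n)) g := by
  obtain ⟨C, hC⟩ := H
  refine ⟨C + C * k, fun n => (hC _).trans ?_⟩
  have h1 : g (C * (k * n)) ≤ g ((C + C * k) * n) := hg (by nlinarith)
  have h2 := Nat.mul_le_mul (Nat.le_add_right C (C * k)) h1
  refine Nat.add_le_add h2 ?_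
  nlinarith

/-- The Dehn function of a retract is dominated by that of the group. -/
theorem dominated_of_retract [Finite α] [Finite β] (hS : S.Finite)
    (f : FreeGroup α →* FreeGroup β) (k : FreeGroup β →* FreeGroup α)
    (hf : ∀ r ∈ R, f r ∈ Subgroup.normalClosure S)
    (hk : ∀ r ∈ S, k r ∈ Subgroup.normalClosure R)
    (hkf : ∀ a, k (f (FreeGroup.of a)) * (FreeGroup.of a)⁻¹ ∈ Subgroup.normalClosure R) :
    Dominated (dehnFunction R) (dehnFunction S) := by
  classical
  obtain ⟨c₁, hc₁⟩ : ∃ c, ∀ a, (f (FreeGroup.of a)).norm ≤ c := by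
    obtain ⟨c, hc⟩ := (Set.finite_range fun a => (f (FreeGroup.of a)).norm).bddAbove
    exact ⟨c, fun a => hc ⟨a, rfl⟩⟩
  obtain ⟨c₂, hc₂⟩ : ∃ c, ∀ r ∈ S, Near R c (k r) 1 := by
    obtain ⟨c, hc⟩ := (hS.image fun r => area R (k r)).bddAbove
    exact ⟨c, fun r hr => (near_area (hk r hr)).mono (hc ⟨r, hr, rfl⟩)⟩
  obtain ⟨c₃, hc₃⟩ : ∃ c, ∀ a, Near R c (k (f (FreeGroup.of a))) (FreeGroup.of a) := by
    obtain ⟨c, hc⟩ := (Set.finite_range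
      fun a => area R (k (f (FreeGroup.of a)) * (FreeGroup.of a)⁻¹)).bddAbove
    refine ⟨c, fun a => ?_⟩
    simpa using ((near_area (hkf a)).mono (hc ⟨a, rfl⟩)).mul_right (FreeGroup.of a)
  -- Undoing `k ∘ f` letter by letter costs linearly many relators, which the linear term of
  -- `Dominated` absorbs. The rest is a filling of `f g` over `S`, pushed back along `k`.
  have hkf' : ∀ w : List (α × Bool),
      Near R (w.length * c₃) (k (f (FreeGroup.mk w))) (FreeGroup.mk w) := by
    intro w
    induction w with
    | nil => exact near_of_eq (by simp [← FreeGroup.one_eq_mk]) _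
    | cons x w ih =>
      rw [mk_cons_eq, map_mul, map_mul, List.length_cons, add_mul, one_mul, add_comm]
      refine Near.mul ?_ ih
      obtain ⟨a, _ | _⟩ := x
      · rw [mk_singleton_false, map_inv, map_inv]
        exact (hc₃ a).inv
      · exact hc₃ a
  refine ⟨c₁ + c₂ + c₃, fun n => dehnFunction_le fun g hg hn => ?_⟩
  have hfg : f g ∈ Subgroup.normalClosure S := by
    have : Subgroup.normalClosure R ≤ (Subgroup.normalClosure S).comap f :=
      Subgroup.normalClosure_le_normal hf
    exact this hg
  have h1 := near_dehnFunction hfg ((norm_map_le f hc₁ g).trans (Nat.mul_le_mul_left c₁ hn))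
  have h2 := h1.map k hc₂
  have h3 := hkf' g.toWord
  rw [FreeGroup.mk_toWord] at h3
  rw [map_one] at h2
  refine (h3.symm.trans h2).mono ?_
  have h4 : dehnFunction S (c₁ * n) ≤ dehnFunction S ((c₁ + c₂ + c₃) * n) :=
    dehnFunction_mono (by nlinarith)
  have h5 : g.toWord.length * c₃ ≤ n * c₃ := Nat.mul_le_mul_right _ hn
  have h6 := Nat.mul_le_mul_right c₂ h4
  nlinarith [Nat.zero_le (c₁ * dehnFunction S ((c₁ + c₂ + c₃) * n)),
    Nat.zero_le (c₃ * dehnFunction S ((c₁ + c₂ + c₃) * n)), Nat.zero_le (c₁ * n),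
    Nat.zero_le (c₂ * n)]

/-- Dehn functions of finite presentations of the same group dominate each other. -/
theorem dominated_of_mulEquiv {G : Type*} [Group G] (hR : IsFinitePresentationOf R G)
    (hS : IsFinitePresentationOf S G) : Dominated (dehnFunction R) (dehnFunction S) := by
  obtain ⟨hα, hRf, ⟨eR⟩⟩ := hR
  obtain ⟨hβ, hSf, ⟨eS⟩⟩ := hS
  have hlift : ∀ a : α, ∃ v, PresentedGroup.mk S v = eS.symm (eR (PresentedGroup.of a)) :=
    fun a => PresentedGroup.mk_surjective S _
  have hlift' : ∀ b : β, ∃ v, PresentedGroup.mk R v = eR.symm (eS (PresentedGroup.of b)) :=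
    fun b => PresentedGroup.mk_surjective R _
  choose f hf using hlift
  choose k hk using hlift'
  have hf' : ∀ v, PresentedGroup.mk S (FreeGroup.lift f v) =
      eS.symm (eR (PresentedGroup.mk R v)) := by
    refine DFunLike.congr_fun (f := (PresentedGroup.mk S).comp (FreeGroup.lift f))
      (g := (eS.symm.toMonoidHom.comp eR.toMonoidHom).comp (PresentedGroup.mk R)) ?_
    ext a
    simpa [PresentedGroup.of] using hf a
  have hk' : ∀ v, PresentedGroup.mk R (FreeGroup.lift k v) =
      eR.symm (eS (PresentedGroup.mk S v)) := by
    refine DFunLike.congr_fun (f := (PresentedGroup.mk R).comp (FreeGroup.lift k))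
      (g := (eR.symm.toMonoidHom.comp eS.toMonoidHom).comp (PresentedGroup.mk S)) ?_
    ext a
    simpa [PresentedGroup.of] using hk a
  refine dominated_of_retract hSf (FreeGroup.lift f) (FreeGroup.lift k) ?_ ?_ ?_
  · intro r hr
    rw [← mk_eq_one_iff_mem, hf', PresentedGroup.one_of_mem hr]
    simp
  · intro r hr
    rw [← mk_eq_one_iff_mem, hk', PresentedGroup.one_of_mem hr]
    simp
  · intro a
    rw [← mk_eq_one_iff_mem, map_mul, hk', hf']
    simp

/-- A surjection from a free group whose kernel elements have fillings gives a presentation. -/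
theorem isFinitePresentationOf_of_ker [Finite α] (hR : R.Finite) {G : Type*} [Group G]
    (π : FreeGroup α →* G) (hπ : Function.Surjective π) (hker : π.ker = Subgroup.normalClosure R) :
    IsFinitePresentationOf R G :=
  ⟨inferInstance, hR, ⟨(QuotientGroup.quotientMulEquivOfEq hker.symm).trans
    (QuotientGroup.quotientKerEquivOfSurjective π hπ)⟩⟩

theorem IsFinitePresentationOf.isFinitelyPresented {G : Type*} [Group G]
    (hR : IsFinitePresentationOf R G) : Group.IsFinitelyPresented G := by
  obtain ⟨hα, hRf, ⟨e⟩⟩ := hR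
  have := hRf.to_subtype
  exact Group.IsFinitelyPresented.equiv e

/-- The kernel of any surjection from a free group of finite rank to a finitely presented group
is the normal closure of a finite set. -/
theorem exists_ker_eq_normalClosure {G : Type*} [Group G] [Finite α]
    (hG : Group.IsFinitelyPresented G) (π : FreeGroup α →* G) (hπ : Function.Surjective π) :
    ∃ R : Set (FreeGroup α), R.Finite ∧ π.ker = Subgroup.normalClosure R := by
  obtain ⟨n, φ, hφ, T, hT, hTφ⟩ := hG.out
  choose f hf using fun i => hπ (φ (FreeGroup.of i))
  choose k hk using fun a => hφ (π (FreeGroup.of a))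
  have hf' : ∀ v, π (FreeGroup.lift f v) = φ v := by
    refine DFunLike.congr_fun (f := π.comp (FreeGroup.lift f)) (g := φ) ?_
    ext a
    simpa using hf a
  have hk' : ∀ v, φ (FreeGroup.lift k v) = π v := by
    refine DFunLike.congr_fun (f := φ.comp (FreeGroup.lift k)) (g := π) ?_
    ext a
    simpa using hk a
  -- Tietze transformations: the old relators rewritten in the new generators, and for each new
  -- generator the relation that equates it with its translation back and forth.
  let R : Set (FreeGroup α) := FreeGroup.lift f '' T ∪
    Set.range fun a => FreeGroup.lift f (k a) * (FreeGroup.of a)⁻¹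
  refine ⟨R, (hT.image _).union (Set.finite_range _), le_antisymm ?_ ?_⟩
  · intro v hv
    have h1 : PresentedGroup.mk R (FreeGroup.lift f (FreeGroup.lift k v)) =
        PresentedGroup.mk R v := by
      refine DFunLike.congr_fun (f := ((PresentedGroup.mk R).comp (FreeGroup.lift f)).comp
        (FreeGroup.lift k)) (g := PresentedGroup.mk R) ?_ v
      ext a
      simpa using PresentedGroup.mk_eq_mk_of_mul_inv_mem (rels := R) (Or.inr ⟨a, rfl⟩)
    have h2 : Subgroup.normalClosure T ≤ (Subgroup.normalClosure R).comap (FreeGroup.lift f) :=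
      Subgroup.normalClosure_le_normal fun t ht => Subgroup.subset_normalClosure
        (Or.inl ⟨t, ht, rfl⟩)
    rw [← mk_eq_one_iff_mem, ← h1, mk_eq_one_iff_mem]
    refine h2 ?_
    rw [hTφ, MonoidHom.mem_ker, hk']
    exact hv
  · refine Subgroup.normalClosure_le_normal ?_
    rintro _ (⟨t, ht, rfl⟩ | ⟨a, rfl⟩)
    · have : t ∈ φ.ker := hTφ ▸ Subgroup.subset_normalClosure ht
      simpa [MonoidHom.mem_ker, hf'] using this
    · have : φ (k a) = π (FreeGroup.of a) := hk a
      simp [MonoidHom.mem_ker, hf', this]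

end Comparison

/-! ### A quadratic lower bound -/

section Heisenberg

/-- The integral Heisenberg group. -/
@[ext]
structure Heis where
  x : ℤ
  y : ℤ
  z : ℤ

namespace Heis

instance : Group Heis where
  mul a b := ⟨a.x + b.x, a.y + b.y, a.z + b.z + a.x * b.y⟩
  one := ⟨0, 0, 0⟩
  inv a := ⟨-a.x, -a.y, -a.z + a.x * a.y⟩
  mul_assoc a b c := by
    ext
    · exact add_assoc _ _ _
    · exact add_assoc _ _ _
    · change a.z + b.z + a.x * b.y + c.z + (a.x + b.x) * c.y =
        a.z + (b.z + c.z + b.x * c.y) + a.x * (b.y + c.y)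
      ring
  one_mul a := by
    ext
    · exact zero_add _
    · exact zero_add _
    · change 0 + a.z + 0 * a.y = a.z
      ring
  mul_one a := by
    ext
    · exact add_zero _
    · exact add_zero _
    · change a.z + 0 + a.x * 0 = a.z
      ring
  inv_mul_cancel a := by
    ext
    · exact neg_add_cancel _
    · exact neg_add_cancel _
    · change -a.z + a.x * a.y + a.z + -a.x * a.y = 0
      ring

@[simp] theorem mul_x (a b : Heis) : (a * b).x = a.x + b.x := rfl
@[simp] theorem mul_y (a b : Heis) : (a * b).y = a.y + b.y := rfl
@[simp] theorem mul_z (a b : Heis) : (a * b).z = a.z + b.z + a.x * b.y := rfl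
@[simp] theorem one_x : (1 : Heis).x = 0 := rfl
@[simp] theorem one_y : (1 : Heis).y = 0 := rfl
@[simp] theorem one_z : (1 : Heis).z = 0 := rfl
@[simp] theorem inv_x (a : Heis) : a⁻¹.x = -a.x := rfl
@[simp] theorem inv_y (a : Heis) : a⁻¹.y = -a.y := rfl
@[simp] theorem inv_z (a : Heis) : a⁻¹.z = -a.z + a.x * a.y := rfl

theorem pow_x (a : Heis) (n : ℕ) : (a ^ n).x = n * a.x := by
  induction n with
  | zero => simp
  | succ n ih => rw [pow_succ, mul_x, ih]; push_cast; ring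

theorem pow_y (a : Heis) (n : ℕ) : (a ^ n).y = n * a.y := by
  induction n with
  | zero => simp
  | succ n ih => rw [pow_succ, mul_y, ih]; push_cast; ring

end Heis

variable {α : Type*} {R : Set (FreeGroup α)}

/-- If a group maps to `ℤ²` so that two commuting elements map to a basis,
then its Dehn function is at least quadratic. -/
theorem dominated_sq [Finite α] (hR : R.Finite) (p q : FreeGroup α →* Multiplicative ℤ)
    (hp : ∀ r ∈ R, p r = 1) (hq : ∀ r ∈ R, q r = 1) (a b : FreeGroup α)
    (hab : PresentedGroup.mk R (a * b) = PresentedGroup.mk R (b * a))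
    (hpa : p a = Multiplicative.ofAdd 1) (hqa : q a = 1) (hpb : p b = 1)
    (hqb : q b = Multiplicative.ofAdd 1) :
    Dominated (fun n => n ^ 2) (dehnFunction R) := by
  classical
  -- This lifts `(p, q)` to the Heisenberg group. Relators become central, where conjugation does
  -- nothing and `z` is additive, so `z` bounds the number of relators from below up to the factor
  -- `c`.
  let h : FreeGroup α →* Heis := FreeGroup.lift fun i =>
    ⟨(p (FreeGroup.of i)).toAdd, (q (FreeGroup.of i)).toAdd, 0⟩
  have hx : ∀ g, (h g).x = (p g).toAdd := by
    intro g
    induction g using FreeGroup.induction_on with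
    | C1 => simp
    | of i => simp [h]
    | inv_of i _ => simp [h]
    | mul u v hu hv => simp [hu, hv]
  have hy : ∀ g, (h g).y = (q g).toAdd := by
    intro g
    induction g using FreeGroup.induction_on with
    | C1 => simp
    | of i => simp [h]
    | inv_of i _ => simp [h]
    | mul u v hu hv => simp [hu, hv]
  obtain ⟨c, hc⟩ := (hR.image fun r => (h r).z.natAbs).bddAbove
  have hcr : ∀ r ∈ R, (h r).z.natAbs ≤ c := fun r hr => hc ⟨r, hr, rfl⟩
  have key : ∀ L : List (FreeGroup α),
      (∀ x ∈ L, ∃ u r : FreeGroup α, (r ∈ R ∨ r⁻¹ ∈ R) ∧ x = u * r * u⁻¹) →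
      (h L.prod).x = 0 ∧ (h L.prod).y = 0 ∧ (h L.prod).z.natAbs ≤ L.length * c := by
    intro L
    induction L with
    | nil => simp
    | cons x L ih =>
      intro hL
      obtain ⟨i1, i2, i3⟩ := ih fun y hy => hL y (List.mem_cons_of_mem _ hy)
      obtain ⟨u, r, hr, rfl⟩ := hL _ List.mem_cons_self
      have hr' : (h r).x = 0 ∧ (h r).y = 0 ∧ (h r).z.natAbs ≤ c := by
        rcases hr with hr | hr
        · exact ⟨by rw [hx, hp r hr]; rfl, by rw [hy, hq r hr]; rfl, hcr r hr⟩
        · have h1 : (h r).x = 0 := by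
            have := hp _ hr
            rw [map_inv, inv_eq_one] at this
            rw [hx, this]; rfl
          have h2 : (h r).y = 0 := by
            have := hq _ hr
            rw [map_inv, inv_eq_one] at this
            rw [hy, this]; rfl
          have h3 := hcr _ hr
          rw [map_inv, Heis.inv_z, h1] at h3
          exact ⟨h1, h2, by simpa using h3⟩
      obtain ⟨r1, r2, r3⟩ := hr'
      rw [List.prod_cons, map_mul, map_mul, map_mul, map_inv]
      simp only [Heis.mul_x, Heis.mul_y, Heis.mul_z, Heis.inv_x, Heis.inv_y, Heis.inv_z,
        List.length_cons, r1, r2, i1, i2]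
      refine ⟨by ring, by ring, ?_⟩
      have : (h u).z + (h r).z + (h u).x * 0 + (-(h u).z + (h u).x * (h u).y) +
          ((h u).x + 0) * -(h u).y + (h L.prod).z +
          ((h u).x + 0 + -(h u).x) * 0 = (h r).z + (h L.prod).z := by ring
      rw [this, add_mul, one_mul, add_comm]
      exact (Int.natAbs_add_le _ _).trans (by omega)
  -- The test word is the commutator of `a ^ n` and `b ^ n`, of length at most `2 * (a.norm +
  -- b.norm) * n`. Its `z` is `n²` whatever the `z` of `a` and `b`, so `n²` is at most `c` times its
  -- area.
  refine ⟨c + 2 * (a.norm + b.norm), fun n => ?_⟩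
  let w : FreeGroup α := a ^ n * b ^ n * (b ^ n * a ^ n)⁻¹
  have hw : w ∈ Subgroup.normalClosure R := by
    have hcomm : Commute (PresentedGroup.mk R a) (PresentedGroup.mk R b) := by
      simpa [Commute, SemiconjBy] using hab
    rw [← mk_eq_one_iff_mem]
    simp only [w, map_mul, map_inv, map_pow]
    rw [(hcomm.pow_pow n n).eq, mul_inv_cancel]
  have hnorm : w.norm ≤ 2 * (a.norm + b.norm) * n := by
    have h1 : (a ^ n).norm ≤ n * a.norm := by simpa using norm_zpow_le a n
    have h2 : (b ^ n).norm ≤ n * b.norm := by simpa using norm_zpow_le b n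
    have h3 := FreeGroup.norm_mul_le (a ^ n * b ^ n) (b ^ n * a ^ n)⁻¹
    have h4 := FreeGroup.norm_mul_le (a ^ n) (b ^ n)
    have h5 := FreeGroup.norm_mul_le (b ^ n) (a ^ n)
    rw [FreeGroup.norm_inv_eq] at h3
    nlinarith
  obtain ⟨L, hL, hlen⟩ := near_dehnFunction hw (hnorm.trans
    (Nat.mul_le_mul_right n (Nat.le_add_left _ c)))
  obtain ⟨-, -, hz⟩ := key L hL.1
  have hzw : (h w).z = n * n := by
    have h1 : (h a).x = 1 := by rw [hx, hpa]; rfl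
    have h2 : (h a).y = 0 := by rw [hy, hqa]; rfl
    have h3 : (h b).x = 0 := by rw [hx, hpb]; rfl
    have h4 : (h b).y = 1 := by rw [hy, hqb]; rfl
    simp only [w, map_mul, map_inv, map_pow, Heis.mul_z, Heis.inv_z, Heis.mul_x, Heis.mul_y,
      Heis.inv_y, Heis.pow_x, Heis.pow_y, h1, h2, h3, h4]
    ring
  have hLw : L.prod = w := by simpa using hL.2
  rw [hLw, hzw] at hz
  have hz' : n * n ≤ L.length * c := by
    have : ((n : ℤ) * n).natAbs = n * n := by rw [Int.natAbs_mul]; simp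
    rwa [this] at hz
  have := Nat.mul_le_mul_right c hlen
  nlinarith [Nat.zero_le (2 * (a.norm + b.norm) *
    dehnFunction R ((c + 2 * (a.norm + b.norm)) * n)),
    Nat.zero_le ((c + 2 * (a.norm + b.norm)) * n)]

end Heisenberg


/-! ### The kernel of `F(A)⁴ → ℤ²` -/

section Kernel

variable {C : Type*}

/-- The exponent sum of one of the two distinguished generators. -/
def exponent (C : Type*) (r : Fin 2) : FreeGroup (Fin 2 ⊕ C) →* Multiplicative ℤ :=
  FreeGroup.lift (Sum.elim (fun s => if s = r then Multiplicative.ofAdd 1 else 1) fun _ => 1)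

/-- The distinguished generators of a factor. -/
def gen (C : Type*) (r : Fin 2) : FreeGroup (Fin 2 ⊕ C) := FreeGroup.of (Sum.inl r)

/-- Generators of the kernel: `inl (r, i, j)` stands for the quotient of the `r`-th distinguished
generators of the factors `i` and `j`, and `inr (i, c)` for the generator `c` of the factor `i`. -/
abbrev KerGen (C : Type*) := (Fin 2 × Fin 4 × Fin 4) ⊕ (Fin 4 × C)

/-- The quotient of the `r`-th distinguished generators of the factors `i` and `j`. -/
def quot (C : Type*) (r : Fin 2) (i j : Fin 4) : FreeGroup (KerGen C) :=
  FreeGroup.of (Sum.inl (r, i, j))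

/-- The projection to the `m`-th factor. -/
def coord (C : Type*) (m : Fin 4) : FreeGroup (KerGen C) →* FreeGroup (Fin 2 ⊕ C) :=
  FreeGroup.lift (Sum.elim
    (fun e => (if e.2.1 = m then gen C e.1 else 1) * (if e.2.2 = m then (gen C e.1)⁻¹ else 1))
    fun c => if c.1 = m then FreeGroup.of (Sum.inr c.2) else 1)

/-- The section of the projection to the `i`-th factor that balances the exponents of the two
distinguished generators in the factors `k` and `l`, respectively. -/
def sect (C : Type*) (i k l : Fin 4) : FreeGroup (Fin 2 ⊕ C) →* FreeGroup (KerGen C) :=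
  FreeGroup.lift (Sum.elim (fun r => quot C r i (![k, l] r)) fun c => FreeGroup.of (Sum.inr (i, c)))

@[simp] theorem exponent_gen (r s : Fin 2) :
    exponent C r (gen C s) = if s = r then Multiplicative.ofAdd 1 else 1 := by
  simp [exponent, gen]

@[simp] theorem exponent_of_inr (r : Fin 2) (c : C) :
    exponent C r (FreeGroup.of (Sum.inr c)) = 1 := by
  simp [exponent]

theorem natAbs_exponent_of_le (r : Fin 2) (a : Fin 2 ⊕ C) :
    (exponent C r (FreeGroup.of a)).toAdd.natAbs ≤ 1 := by
  rcases a with s | c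
  · simp only [exponent, FreeGroup.lift_apply_of, Sum.elim_inl]
    split_ifs <;> simp
  · simp

theorem coord_quot (m : Fin 4) (r : Fin 2) (i j : Fin 4) :
    coord C m (quot C r i j) =
      gen C r ^ ((if i = m then 1 else 0) - (if j = m then 1 else 0) : ℤ) := by
  simp only [coord, quot, FreeGroup.lift_apply_of, Sum.elim_inl]
  split_ifs <;> simp

theorem coord_of_inr (m i : Fin 4) (c : C) :
    coord C m (FreeGroup.of (Sum.inr (i, c))) =
      if i = m then FreeGroup.of (Sum.inr c) else 1 := by
  simp [coord]

@[simp] theorem sect_gen (i k l : Fin 4) (r : Fin 2) :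
    sect C i k l (gen C r) = quot C r i (![k, l] r) := by
  simp [sect, gen]

@[simp] theorem sect_of_inl (i k l : Fin 4) (r : Fin 2) :
    sect C i k l (FreeGroup.of (Sum.inl r)) = quot C r i (![k, l] r) :=
  sect_gen i k l r

@[simp] theorem sect_of_inr (i k l : Fin 4) (c : C) :
    sect C i k l (FreeGroup.of (Sum.inr c)) = FreeGroup.of (Sum.inr (i, c)) := by
  simp [sect]

/-- As `k ≠ l`, each compensating factor only sees powers of a single generator, which are
determined by the exponent of `v`. -/
theorem coord_sect (m : Fin 4) {i k l : Fin 4} (h : [i, k, l].Nodup) (v : FreeGroup (Fin 2 ⊕ C)) :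
    coord C m (sect C i k l v) = if m = i then v else
      if m = k then gen C 0 ^ (-(exponent C 0 v).toAdd) else
      if m = l then gen C 1 ^ (-(exponent C 1 v).toAdd) else 1 := by
  have hik : i ≠ k := by rintro rfl; simp at h
  have hil : i ≠ l := by rintro rfl; simp at h
  have hkl : k ≠ l := by rintro rfl; simp at h
  have key : ∀ f : FreeGroup (Fin 2 ⊕ C) →* FreeGroup (Fin 2 ⊕ C),
      (∀ r, coord C m (sect C i k l (gen C r)) = f (gen C r)) →
      (∀ c, coord C m (sect C i k l (FreeGroup.of (Sum.inr c))) = f (FreeGroup.of (Sum.inr c))) →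
      coord C m (sect C i k l v) = f v := by
    intro f h1 h2
    refine DFunLike.congr_fun (f := (coord C m).comp (sect C i k l)) (g := f) ?_ v
    ext a
    rcases a with r | c
    · exact h1 r
    · exact h2 c
  split_ifs with h1 h2 h3
  · subst h1
    refine key (MonoidHom.id _) (fun r => ?_) fun c => ?_
    · fin_cases r <;> simp [coord_quot, hik.symm, hil.symm]
    · simp [coord_of_inr]
  · subst h2
    refine key (((zpowersHom _ (gen C 0)⁻¹)).comp (exponent C 0)) (fun r => ?_) (fun c => ?_)
      |>.trans ?_
    · fin_cases r <;> simp [coord_quot, hik, hkl.symm]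
    · simp [coord_of_inr, hik]
    · simp
  · subst h3
    refine key (((zpowersHom _ (gen C 1)⁻¹)).comp (exponent C 1)) (fun r => ?_) (fun c => ?_)
      |>.trans ?_
    · fin_cases r <;> simp [coord_quot, hil, hkl]
    · simp [coord_of_inr, hil]
    · simp
  · refine key 1 (fun r => ?_) (fun c => ?_)
    · fin_cases r <;> simp [coord_quot, Ne.symm h1, Ne.symm h2, Ne.symm h3]
    · simp [coord_of_inr, Ne.symm h1]

theorem exponent_coord_prod (r : Fin 2) (w : FreeGroup (KerGen C)) :
    exponent C r (coord C 0 w) * exponent C r (coord C 1 w) * exponent C r (coord C 2 w) *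
      exponent C r (coord C 3 w) = 1 := by
  let f : FreeGroup (KerGen C) →* Multiplicative ℤ :=
    (exponent C r).comp (coord C 0) * (exponent C r).comp (coord C 1) *
      (exponent C r).comp (coord C 2) * (exponent C r).comp (coord C 3)
  have : f = 1 := by
    ext a
    rcases a with ⟨s, i, j⟩ | ⟨i, c⟩
    · change exponent C r (coord C 0 (quot C s i j)) * exponent C r (coord C 1 (quot C s i j)) *
        exponent C r (coord C 2 (quot C s i j)) * exponent C r (coord C 3 (quot C s i j)) = 1
      simp only [coord_quot, map_zpow, ← zpow_add]
      fin_cases i <;> fin_cases j <;> simp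
    · change exponent C r (coord C 0 (FreeGroup.of _)) * exponent C r (coord C 1 (FreeGroup.of _)) *
        exponent C r (coord C 2 (FreeGroup.of _)) * exponent C r (coord C 3 (FreeGroup.of _)) = 1
      simp only [coord_of_inr]
      fin_cases i <;> simp
  exact DFunLike.congr_fun this w

/-! ### Length estimates, short relators and relations between sections -/

variable [DecidableEq C]

@[simp] theorem norm_gen (r : Fin 2) : (gen C r).norm = 1 := FreeGroup.norm_of _

@[simp] theorem norm_quot (r : Fin 2) (i j : Fin 4) : (quot C r i j).norm = 1 :=
  FreeGroup.norm_of _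

theorem norm_gen_zpow_le (r : Fin 2) (k : ℤ) : (gen C r ^ k).norm ≤ k.natAbs := by
  simpa using norm_zpow_le (gen C r) k

theorem norm_sect_le (i k l : Fin 4) (v : FreeGroup (Fin 2 ⊕ C)) :
    (sect C i k l v).norm ≤ v.norm := by
  refine (norm_map_le (c := 1) _ (fun a => ?_) v).trans (by simp)
  rcases a with r | c <;> simp

theorem norm_coord_le (m : Fin 4) (w : FreeGroup (KerGen C)) : (coord C m w).norm ≤ 2 * w.norm := by
  refine norm_map_le _ (fun a => ?_) w
  rcases a with ⟨r, i, j⟩ | ⟨i, c⟩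
  · change (coord C m (quot C r i j)).norm ≤ 2
    rw [coord_quot]
    refine (norm_gen_zpow_le _ _).trans ?_
    split_ifs <;> simp
  · rw [coord_of_inr]
    split_ifs <;> simp

theorem natAbs_exponent_le (r : Fin 2) (v : FreeGroup (Fin 2 ⊕ C)) :
    (exponent C r v).toAdd.natAbs ≤ v.norm := by
  simpa using natAbs_toAdd_le _ (natAbs_exponent_of_le r) v

/-- Short words all of whose projections are trivial. -/
def shortRelators (C : Type*) [DecidableEq C] : Set (FreeGroup (KerGen C)) :=
  {g | g.norm ≤ 30 ∧ ∀ m, coord C m g = 1}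

variable {S : Set (FreeGroup (KerGen C))}

/-- Every short identity valid in the product of four free groups is itself a relator, so none has
to be listed. The bound `30` is generous: the longest use, the base case of `near_normalForm`, has
total length at most `17`. -/
theorem near_of_coord (hS : shortRelators C ⊆ S) {g h : FreeGroup (KerGen C)}
    (hn : g.norm + h.norm ≤ 30) (H : ∀ m, coord C m g = coord C m h) : Near S 1 g h := by
  refine near_of_mem (hS ⟨(FreeGroup.norm_mul_le _ _).trans ?_, fun m => ?_⟩)
  · rwa [FreeGroup.norm_inv_eq]
  · rw [map_mul, map_inv, H, mul_inv_cancel]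

theorem near_comm_of (hS : shortRelators C ⊆ S) (a b : KerGen C)
    (H : ∀ m, coord C m (FreeGroup.of a * FreeGroup.of b) =
      coord C m (FreeGroup.of b * FreeGroup.of a)) :
    Near S 1 (FreeGroup.of a * FreeGroup.of b) (FreeGroup.of b * FreeGroup.of a) := by
  refine near_of_coord hS ?_ H
  have h1 := FreeGroup.norm_mul_le (FreeGroup.of a) (FreeGroup.of b)
  have h2 := FreeGroup.norm_mul_le (FreeGroup.of b) (FreeGroup.of a)
  simp only [FreeGroup.norm_of] at h1 h2
  omega

theorem near_quot_comm_quot (hS : shortRelators C ⊆ S) (r : Fin 2) (i j k l : Fin 4) :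
    Near S 1 (quot C r i j * quot C r k l) (quot C r k l * quot C r i j) := by
  refine near_comm_of hS _ _ fun m => ?_
  change coord C m (quot C r i j * quot C r k l) = coord C m (quot C r k l * quot C r i j)
  rw [map_mul, map_mul, coord_quot, coord_quot, ← zpow_add, ← zpow_add, add_comm]

theorem near_quot_comm_quot_of_ne (hS : shortRelators C ⊆ S) (r s : Fin 2) {i j k l : Fin 4}
    (hik : i ≠ k) (hil : i ≠ l) (hjk : j ≠ k) (hjl : j ≠ l) :
    Near S 1 (quot C r i j * quot C s k l) (quot C s k l * quot C r i j) := by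
  refine near_comm_of hS _ _ fun m => ?_
  change coord C m (quot C r i j * quot C s k l) = coord C m (quot C s k l * quot C r i j)
  rw [map_mul, map_mul, coord_quot, coord_quot]
  by_cases h1 : i = m
  · subst h1; simp [hik.symm, hil.symm]
  · by_cases h2 : j = m
    · subst h2; simp [hjk.symm, hjl.symm]
    · simp [h1, h2]

theorem near_of_inr_comm_quot (hS : shortRelators C ⊆ S) (c : C) (r : Fin 2) {i j k : Fin 4}
    (hij : i ≠ j) (hik : i ≠ k) :
    Near S 1 (FreeGroup.of (Sum.inr (i, c)) * quot C r j k)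
      (quot C r j k * FreeGroup.of (Sum.inr (i, c))) := by
  refine near_comm_of hS _ _ fun m => ?_
  change coord C m (_ * quot C r j k) = coord C m (quot C r j k * _)
  rw [map_mul, map_mul, coord_quot, coord_of_inr]
  by_cases h1 : i = m
  · subst h1; simp [hij.symm, hik.symm]
  · simp [h1]

theorem near_of_inr_comm_of_inr (hS : shortRelators C ⊆ S) (c d : C) {i j : Fin 4} (hij : i ≠ j) :
    Near S 1 (FreeGroup.of (Sum.inr (i, c)) * FreeGroup.of (Sum.inr (j, d)))
      (FreeGroup.of (Sum.inr (j, d)) * FreeGroup.of (Sum.inr (i, c))) := by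
  refine near_comm_of hS _ _ fun m => ?_
  rw [map_mul, map_mul, coord_of_inr, coord_of_inr]
  by_cases h1 : i = m
  · subst h1; simp [hij.symm]
  · simp [h1]

theorem near_quot_mul_quot (hS : shortRelators C ⊆ S) (r : Fin 2) (i j k : Fin 4) :
    Near S 1 (quot C r i k) (quot C r i j * quot C r j k) := by
  refine near_of_coord hS ?_ fun m => ?_
  · have := FreeGroup.norm_mul_le (quot C r i j) (quot C r j k)
    simp only [norm_quot] at this ⊢
    omega
  · rw [map_mul, coord_quot, coord_quot, coord_quot, ← zpow_add]
    congr 1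
    ring

theorem near_quot_inv (hS : shortRelators C ⊆ S) (r : Fin 2) (i j : Fin 4) :
    Near S 1 (quot C r i j) (quot C r j i)⁻¹ := by
  refine near_of_coord hS ?_ fun m => ?_
  · rw [FreeGroup.norm_inv_eq, norm_quot, norm_quot]; norm_num
  · rw [map_inv, coord_quot, coord_quot, ← zpow_neg]
    congr 1
    ring

/-- Quotients of the same `x_r` commute because all their coordinates are powers of `x_r`. Quotients
of different ones live in disjoint pairs of factors, such as `i, k` and `j, l`. -/
theorem near_sect_comm_sect (hS : shortRelators C ⊆ S) {i j k l : Fin 4} (h : [i, j, k, l].Nodup)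
    (u v : FreeGroup (Fin 2 ⊕ C)) :
    Near S (u.norm * v.norm) (sect C i k l u * sect C j k l v)
      (sect C j k l v * sect C i k l u) := by
  simp only [List.nodup_cons, List.mem_cons, List.not_mem_nil, not_or, or_false] at h
  obtain ⟨⟨hij, hik, hil⟩, ⟨hjk, hjl⟩, hkl, -⟩ := h
  have := near_comm_map (T := S) (c := 1) (sect C i k l) (sect C j k l) ?_ u v
  · simpa using this
  rintro (r | c) (s | d)
  · simp only [sect_of_inl]
    by_cases hrs : r = s
    · subst hrs
      exact near_quot_comm_quot hS _ _ _ _ _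
    · refine near_quot_comm_quot_of_ne hS _ _ hij ?_ ?_ ?_
      · fin_cases s <;> simpa
      · fin_cases r <;> simp [Ne.symm hjk, Ne.symm hjl]
      · fin_cases r <;> fin_cases s <;> simp_all [Ne.symm hkl]
  · simp only [sect_of_inl, sect_of_inr]
    refine (near_of_inr_comm_quot hS _ _ (Ne.symm hij) ?_).symm
    fin_cases r <;> simpa
  · simp only [sect_of_inl, sect_of_inr]
    refine near_of_inr_comm_quot hS _ _ hij ?_
    fin_cases s <;> simpa
  · simp only [sect_of_inr]
    exact near_of_inr_comm_of_inr hS _ _ hij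

/-- The vectors put the compensation of `x_r` in factor `k` and that of the other generator in `l`,
so factor `k`, shared with the quotient, only sees powers of `x_r`. -/
theorem near_sect_comm_quot (hS : shortRelators C ⊆ S) {i j k l : Fin 4} (h : [i, j, k, l].Nodup)
    (r : Fin 2) (v : FreeGroup (Fin 2 ⊕ C)) :
    Near S v.norm (sect C i (![k, l] r) (![l, k] r) v * quot C r j k)
      (quot C r j k * sect C i (![k, l] r) (![l, k] r) v) := by
  simp only [List.nodup_cons, List.mem_cons, List.not_mem_nil, not_or, or_false] at h
  obtain ⟨⟨hij, hik, hil⟩, ⟨hjk, hjl⟩, hkl, -⟩ := h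
  have := near_comm_map_left (T := S) (c := 1) (b := quot C r j k)
    (sect C i (![k, l] r) (![l, k] r)) ?_ v
  · simpa using this
  rintro (s | c)
  · simp only [sect_of_inl]
    by_cases hrs : s = r
    · subst hrs
      exact near_quot_comm_quot hS _ _ _ _ _
    · refine near_quot_comm_quot_of_ne hS _ _ hij hik ?_ ?_
      · fin_cases r <;> fin_cases s <;> simp_all
        · exact Ne.symm hjl
        · exact Ne.symm hjl
      · fin_cases r <;> fin_cases s <;> simp_all
        · exact Ne.symm hkl
        · exact Ne.symm hkl
  · simp only [sect_of_inr]
    exact near_of_inr_comm_quot hS _ _ hij hik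

/-- The compensation of `x₀` moves from `k` to `j` by splitting `quot 0 i k` as `quot 0 i j * quot 0
j k`; the last quotient commutes with the new section, so `near_twist` applies. -/
theorem near_sect_twist_zero (hS : shortRelators C ⊆ S) {i j k l : Fin 4}
    (h : [i, j, k, l].Nodup) (v : FreeGroup (Fin 2 ⊕ C)) :
    Near S (3 * v.norm ^ 2) (sect C i k l v)
      (sect C i j l v * quot C 0 j k ^ (exponent C 0 v).toAdd) := by
  simp only [List.nodup_cons, List.mem_cons, List.not_mem_nil, not_or, or_false] at h
  obtain ⟨⟨hij, hik, hil⟩, ⟨hjk, hjl⟩, hkl, -⟩ := h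
  refine near_twist _ _ _ _ (natAbs_exponent_of_le 0) ?_ ?_ v
  · rintro (r | c)
    · fin_cases r
      · simpa [exponent] using near_quot_mul_quot hS 0 i j k
      · exact near_of_eq (by simp [exponent]) 1
    · exact near_of_eq (by simp [exponent]) 1
  · rintro (r | c)
    · fin_cases r
      · exact near_quot_comm_quot hS _ _ _ _ _
      · exact near_quot_comm_quot_of_ne hS _ _ hij hik (Ne.symm hjl) (Ne.symm hkl)
    · rw [sect_of_inr]
      exact near_of_inr_comm_quot hS _ _ hij hik

theorem near_sect_twist_one (hS : shortRelators C ⊆ S) {i j k l : Fin 4}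
    (h : [i, j, k, l].Nodup) (v : FreeGroup (Fin 2 ⊕ C)) :
    Near S (3 * v.norm ^ 2) (sect C i k l v)
      (sect C i k j v * quot C 1 j l ^ (exponent C 1 v).toAdd) := by
  simp only [List.nodup_cons, List.mem_cons, List.not_mem_nil, not_or, or_false] at h
  obtain ⟨⟨hij, hik, hil⟩, ⟨hjk, hjl⟩, hkl, -⟩ := h
  refine near_twist _ _ _ _ (natAbs_exponent_of_le 1) ?_ ?_ v
  · rintro (r | c)
    · fin_cases r
      · exact near_of_eq (by simp [exponent]) 1
      · simpa [exponent] using near_quot_mul_quot hS 1 i j l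
    · exact near_of_eq (by simp [exponent]) 1
  · rintro (r | c)
    · fin_cases r
      · exact near_quot_comm_quot_of_ne hS _ _ hij hil (Ne.symm hjk) hkl
      · exact near_quot_comm_quot hS _ _ _ _ _
    · rw [sect_of_inr]
      exact near_of_inr_comm_quot hS _ _ hij hil

/-- On elements with trivial exponents, all sections of the projection to the `i`-th factor
agree up to a quadratic number of relators. -/
theorem near_sect_sect (hS : shortRelators C ⊆ S) {i k l k' l' : Fin 4}
    (h : [i, k, l].Nodup) (h' : [i, k', l'].Nodup) {v : FreeGroup (Fin 2 ⊕ C)}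
    (hv : ∀ r, exponent C r v = 1) :
    Near S (15 * v.norm ^ 2) (sect C i k l v) (sect C i k' l' v) := by
  have s0 : ∀ {j k l : Fin 4}, [i, j, k, l].Nodup →
      Near S (3 * v.norm ^ 2) (sect C i k l v) (sect C i j l v) := fun h => by
    simpa [hv] using near_sect_twist_zero hS h v
  have s1 : ∀ {j k l : Fin 4}, [i, j, k, l].Nodup →
      Near S (3 * v.norm ^ 2) (sect C i k l v) (sect C i k j v) := fun h => by
    simpa [hv] using near_sect_twist_one hS h v
  have fourth : ∀ i k l : Fin 4, [i, k, l].Nodup → ∃ j, [i, j, k, l].Nodup := by decide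
  have mem : ∀ i j k l : Fin 4, [i, j, k, l].Nodup → ∀ a, a ≠ i → a = k ∨ a = l ∨ a = j := by
    decide
  obtain ⟨j, hj⟩ := fourth i k l h
  replace mem := mem i j k l hj
  -- Moving one compensation at a time into the free factor, the pair `(k, l)` runs through `(j,
  -- l)`, `(j, k)`, `(l, k)`, `(l, j)`, `(k, j)`. These are all ordered pairs, reached in at most
  -- five moves of cost `3 * v.norm ^ 2`.
  have e1 := s0 hj
  have e2 := e1.trans (s1 (by grind : [i, k, j, l].Nodup))
  have e3 := e2.trans (s0 (by grind : [i, l, j, k].Nodup))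
  have e4 := e3.trans (s1 (by grind : [i, j, l, k].Nodup))
  have e5 := e4.trans (s0 (by grind : [i, k, l, j].Nodup))
  simp only [List.nodup_cons, List.mem_cons, List.not_mem_nil, not_or, or_false] at h'
  obtain ⟨⟨h1, h2⟩, h3, -⟩ := h'
  rcases mem k' (Ne.symm h1) with rfl | rfl | rfl <;> rcases mem l' (Ne.symm h2) with rfl | rfl | rfl
  · exact absurd rfl h3
  · exact near_of_eq rfl _
  · exact e5.mono (by omega)
  · exact e3.mono (by omega)
  · exact absurd rfl h3
  · exact e4.mono (by omega)
  · exact e2.mono (by omega)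
  · exact e1.mono (by omega)
  · exact absurd rfl h3

end Kernel


/-! ### Commutators of exponent-zero elements and powers of quotients -/

section Kernel

variable {C : Type*} [DecidableEq C] {S : Set (FreeGroup (KerGen C))}

/-- Exponent zero allows both sections to be switched to the compensating pair complementary to `i,
j`, where they commute; `61 = 2 * 15 + 2 * 15 + 1`. -/
theorem near_kernel_comm_kernel (hS : shortRelators C ⊆ S) {i k l j k' l' : Fin 4} (hij : i ≠ j)
    (h : [i, k, l].Nodup) (h' : [j, k', l'].Nodup) {u v : FreeGroup (Fin 2 ⊕ C)}
    (hu : ∀ r, exponent C r u = 1) (hv : ∀ r, exponent C r v = 1) {n : ℕ} (hun : u.norm ≤ n)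
    (hvn : v.norm ≤ n) :
    Near S (61 * n ^ 2) (sect C i k l u * sect C j k' l' v)
      (sect C j k' l' v * sect C i k l u) := by
  have others : ∀ i j : Fin 4, i ≠ j → ∃ a b, [i, j, a, b].Nodup := by decide
  obtain ⟨a, b, hab⟩ := others i j hij
  have h1 := near_sect_sect hS h (by grind : [i, a, b].Nodup) hu
  have h2 := near_sect_sect hS h' (by grind : [j, a, b].Nodup) hv
  refine (h1.comm_congr h2 (near_sect_comm_sect hS hab u v)).mono ?_
  have h3 := Nat.pow_le_pow_left hun 2
  have h4 := Nat.pow_le_pow_left hvn 2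
  have h5 := Nat.mul_le_mul hun hvn
  rw [← sq] at h5
  omega

/-- Here the section is switched to one that compensates `x_r` in factor `j'`. The constant `31`
would do; `61` matches `near_kernel_comm_kernel`. -/
theorem near_kernel_comm_quot (hS : shortRelators C ⊆ S) {i k l j j' : Fin 4}
    (h : [i, k, l].Nodup) (h' : [i, j, j'].Nodup) (r : Fin 2) {u : FreeGroup (Fin 2 ⊕ C)}
    (hu : ∀ r, exponent C r u = 1) (p : ℤ) {n : ℕ} (hun : u.norm ≤ n) (hpn : p.natAbs ≤ n) :
    Near S (61 * n ^ 2) (sect C i k l u * quot C r j j' ^ p)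
      (quot C r j j' ^ p * sect C i k l u) := by
  have fourth : ∀ i j j' : Fin 4, [i, j, j'].Nodup → ∃ a, [i, j, j', a].Nodup := by decide
  obtain ⟨a, ha⟩ := fourth i j j' h'
  have h1 := near_sect_sect hS h
    (by fin_cases r <;> simp <;> grind : [i, ![j', a] r, ![a, j'] r].Nodup) hu
  have h2 := (near_sect_comm_quot hS ha r u).symm.comm_zpow_left p
  refine (h1.comm_congr (Near.refl _) h2.symm).mono ?_
  have h3 := Nat.pow_le_pow_left hun 2
  have h5 := Nat.mul_le_mul hpn hun
  rw [← sq] at h5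
  omega

/-- This is `near_twist` for the free group on one generator, applied to its `p`-th power. -/
theorem near_quot_zpow_mul (hS : shortRelators C ⊆ S) (r : Fin 2) (i j k : Fin 4) (p : ℤ) :
    Near S (3 * p.natAbs ^ 2) (quot C r i k ^ p * quot C r j k ^ (-p)) (quot C r i j ^ p) := by
  let f : FreeGroup Unit →* FreeGroup (KerGen C) := FreeGroup.lift fun _ => quot C r i k
  let g : FreeGroup Unit →* FreeGroup (KerGen C) := FreeGroup.lift fun _ => quot C r i j
  let e : FreeGroup Unit →* Multiplicative ℤ := FreeGroup.lift fun _ => Multiplicative.ofAdd 1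
  have h := near_twist (T := S) f g (quot C r j k) e (fun a => by simp [e])
    (fun a => by simpa [f, g, e] using near_quot_mul_quot hS r i j k)
    (fun a => by simpa [g] using near_quot_comm_quot hS r i j j k) (FreeGroup.of () ^ p)
  have hn : (FreeGroup.of () ^ p).norm ≤ p.natAbs := by simpa using norm_zpow_le (FreeGroup.of ()) p
  have h' := (h.mono (Nat.mul_le_mul_left 3 (Nat.pow_le_pow_left hn 2))).mul_right
    (quot C r j k ^ (-p))
  simpa [f, g, e] using h'

theorem near_quot_zpow_prod (hS : shortRelators C ⊆ S) {i j k l : Fin 4} (hij : i ≠ j)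
    (hil : i ≠ l) (hjk : j ≠ k) (hkl : k ≠ l) (p q : ℤ) :
    Near S (p.natAbs * q.natAbs + 3 * q.natAbs ^ 2 + 3 * p.natAbs ^ 2)
      (quot C 1 i l ^ q * quot C 0 i k ^ p * (quot C 1 j l ^ (-q) * quot C 0 j k ^ (-p)))
      (quot C 1 i j ^ q * quot C 0 i j ^ p) := by
  have h1 := (near_quot_comm_quot_of_ne hS 0 1 hij hil (Ne.symm hjk) hkl).comm_zpow p (-q)
  have h2 := (h1.mul_left (quot C 1 i l ^ q)).mul_right (quot C 0 j k ^ (-p))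
  have h3 := (near_quot_zpow_mul hS 1 i j l q).mul (near_quot_zpow_mul hS 0 i j k p)
  simp only [mul_assoc] at h2 h3 ⊢
  exact (h2.trans h3).mono (by simp; omega)

/-- The product of sections of elements of the `i`-th and `j`-th factors with opposite exponents
is a product of sections of kernel elements and of powers of quotients of generators. -/
theorem near_sect_mul_sect (hS : shortRelators C ⊆ S) {i j k l : Fin 4} (h : [i, j, k, l].Nodup)
    {a b : FreeGroup (Fin 2 ⊕ C)} (hab : ∀ r, exponent C r (a * b) = 1) {n : ℕ} (ha : a.norm ≤ n)
    (hb : b.norm ≤ n) :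
    ∃ (a' b' : FreeGroup (Fin 2 ⊕ C)) (p q : ℤ), (∀ r, exponent C r a' = 1) ∧
      (∀ r, exponent C r b' = 1) ∧ a'.norm ≤ 3 * n ∧ b'.norm ≤ 3 * n ∧ p.natAbs ≤ n ∧
      q.natAbs ≤ n ∧ Near S (7 * n ^ 2) (sect C i k l a * sect C j k l b)
        [sect C i k l a', quot C 1 i j ^ q, quot C 0 i j ^ p, sect C j k l b'].prod := by
  simp only [List.nodup_cons, List.mem_cons, List.not_mem_nil, not_or, or_false] at h
  obtain ⟨⟨hij, hik, hil⟩, ⟨hjk, hjl⟩, hkl, -⟩ := h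
  set p := (exponent C 0 a).toAdd with hp
  set q := (exponent C 1 a).toAdd with hq
  have hpn : p.natAbs ≤ n := (natAbs_exponent_le 0 a).trans ha
  have hqn : q.natAbs ≤ n := (natAbs_exponent_le 1 a).trans ha
  have hx : ∀ s : ℤ, s.natAbs ≤ n → ∀ r, (gen C r ^ s).norm ≤ n := fun s hs r =>
    (norm_gen_zpow_le r s).trans hs
  have hb0 : exponent C 0 b = (exponent C 0 a)⁻¹ := by
    rw [eq_comm, inv_eq_iff_mul_eq_one, ← map_mul, hab]
  have hb1 : exponent C 1 b = (exponent C 1 a)⁻¹ := by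
    rw [eq_comm, inv_eq_iff_mul_eq_one, ← map_mul, hab]
  have hofAdd : ∀ m : Multiplicative ℤ, (Multiplicative.ofAdd (1 : ℤ)) ^ m.toAdd = m := fun m => by
    rw [← ofAdd_zsmul]; simp
  -- The powers carrying the exponents of `a` are split off on its right, and the opposite ones of
  -- `b` on its left. Between them, the compensations in `k` and `l` cancel and quotients of factor
  -- `i` by factor `j` remain.
  refine ⟨a * gen C 0 ^ (-p) * gen C 1 ^ (-q), gen C 0 ^ p * (gen C 1 ^ q * b), p, q,
    ?_, ?_, ?_, ?_, hpn, hqn, ?_⟩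
  · rw [Fin.forall_fin_two]
    constructor <;> simp [hp, hq, hofAdd]
  · rw [Fin.forall_fin_two]
    constructor <;> simp [hp, hq, hofAdd, hb0, hb1]
  · have h1 := FreeGroup.norm_mul_le (a * gen C 0 ^ (-p)) (gen C 1 ^ (-q))
    have h2 := FreeGroup.norm_mul_le a (gen C 0 ^ (-p))
    have h3 := hx (-p) (by simpa) 0
    have h4 := hx (-q) (by simpa) 1
    omega
  · have h1 := FreeGroup.norm_mul_le (gen C 0 ^ p) (gen C 1 ^ q * b)
    have h2 := FreeGroup.norm_mul_le (gen C 1 ^ q) b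
    have h3 := hx p hpn 0
    have h4 := hx q hqn 1
    omega
  · set a' := a * gen C 0 ^ (-p) * gen C 1 ^ (-q) with ha'
    set b' := gen C 0 ^ p * (gen C 1 ^ q * b) with hb'
    have ea : a = a' * gen C 1 ^ q * gen C 0 ^ p := by simp [ha']
    have eb : b = gen C 1 ^ (-q) * gen C 0 ^ (-p) * b' := by simp [hb', mul_assoc]
    have h1 := ((near_quot_zpow_prod hS hij hil hjk hkl p q).mul_left (sect C i k l a')).mul_right
      (sect C j k l b')
    have h3 := Nat.pow_le_pow_left hpn 2
    have h4 := Nat.pow_le_pow_left hqn 2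
    have h5 := Nat.mul_le_mul hpn hqn
    rw [← sq] at h5
    refine (near_of_eq ?_ 0).trans (h1.trans (near_of_eq ?_ 0)) |>.mono ?_
    · conv_lhs => rw [ea, eb]
      simp [mul_assoc]
    · simp [mul_assoc]
    · omega

end Kernel


/-! ### Normal forms in the kernel -/

section Kernel

theorem near_list_prod_comm {α : Type*} {S : Set (FreeGroup α)} {c : ℕ}
    (L M : List (FreeGroup α)) (H : ∀ x ∈ L, ∀ y ∈ M, Near S c (x * y) (y * x)) :
    Near S (L.length * (M.length * c)) (L.prod * M.prod) (M.prod * L.prod) := by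
  have key : ∀ (b : FreeGroup α) (d : ℕ) (L : List (FreeGroup α)),
      (∀ x ∈ L, Near S d (x * b) (b * x)) →
      Near S (L.length * d) (L.prod * b) (b * L.prod) := by
    intro b d L
    induction L with
    | nil => intro _; exact near_of_eq (by simp) _
    | cons x L ih =>
      intro h
      rw [List.prod_cons, List.length_cons, add_mul, one_mul, add_comm]
      exact (h x List.mem_cons_self).comm_mul_left
        (ih fun y hy => h y (List.mem_cons_of_mem _ hy))
  exact key _ _ L fun x hx => (key _ _ M fun y hy => (H x hx y hy).symm).symm

variable {C : Type*}

theorem exponent_gen_zpow (r s : Fin 2) (m : Multiplicative ℤ) :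
    exponent C r (gen C s ^ m.toAdd) = if s = r then m else 1 := by
  rw [map_zpow, exponent_gen]
  split_ifs
  · rw [← ofAdd_zsmul]; simp
  · simp

theorem exponent_gen_zpow_of_ne {r s : Fin 2} (h : s ≠ r) (p : ℤ) :
    exponent C r (gen C s ^ p) = 1 := by
  rw [map_zpow, exponent_gen, if_neg h, one_zpow]

/-- The normal form of an element of the kernel with the given coordinates. -/
def normalForm (v : Fin 4 → FreeGroup (Fin 2 ⊕ C)) : FreeGroup (KerGen C) :=
  sect C 0 2 3 (v 0 * gen C 0 ^ (exponent C 0 (v 2 * v 3)).toAdd) *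
    sect C 1 2 3 (v 1 * gen C 1 ^ (exponent C 1 (v 2 * v 3)).toAdd) *
    (sect C 2 0 1 (v 2) * sect C 3 0 1 (v 3))

theorem coord_normalForm {v : Fin 4 → FreeGroup (Fin 2 ⊕ C)}
    (hv : ∀ r, exponent C r (v 0 * v 1 * v 2 * v 3) = 1) (m : Fin 4) :
    coord C m (normalForm v) = v m := by
  have hv' : ∀ r, (exponent C r (v 0)).toAdd + (exponent C r (v 1)).toAdd +
      (exponent C r (v 2)).toAdd + (exponent C r (v 3)).toAdd = 0 := fun r => by
    simpa using congrArg Multiplicative.toAdd (hv r)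
  have h0 : [(0 : Fin 4), 2, 3].Nodup := by decide
  have h1 : [(1 : Fin 4), 2, 3].Nodup := by decide
  have h2 : [(2 : Fin 4), 0, 1].Nodup := by decide
  have h3 : [(3 : Fin 4), 0, 1].Nodup := by decide
  rw [normalForm]
  simp only [map_mul, coord_sect m h0, coord_sect m h1, coord_sect m h2, coord_sect m h3]
  -- In factors `0` and `1` the correction cancels identically; in factors `2` and `3` the leftover
  -- power has the total exponent, which vanishes by `hv'`.
  have hz : ∀ (r : Fin 2) (p : ℤ) (w : FreeGroup (Fin 2 ⊕ C)), p = 0 →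
      gen C r ^ p * w = w := fun r p w h => by rw [h, zpow_zero, one_mul]
  fin_cases m
  · simp
    group
  · simp
    group
  · simp only [Fin.reduceFinMk, Fin.isValue, Fin.reduceEq, if_true, if_false, mul_one,
      map_zpow, exponent_gen, toAdd_mul, toAdd_zpow, toAdd_one, toAdd_ofAdd]
    rw [← zpow_add, ← zpow_add, ← zpow_add, hz]
    have := hv' 0
    simp only [smul_eq_mul, mul_one, mul_zero]
    linarith
  · simp only [Fin.reduceFinMk, Fin.isValue, Fin.reduceEq, if_true, if_false, one_mul,
      map_zpow, exponent_gen, toAdd_mul, toAdd_zpow, toAdd_one, toAdd_ofAdd]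
    rw [← zpow_add, ← zpow_add, ← zpow_add, hz]
    have := hv' 1
    simp only [smul_eq_mul, mul_one, mul_zero]
    linarith

variable [DecidableEq C] {S : Set (FreeGroup (KerGen C))}

/-- Elements of the kernel supported in complementary pairs of factors commute at quadratic
cost. -/
theorem near_cross_comm (hS : shortRelators C ⊆ S) {i j k l : Fin 4} (h : [i, j, k, l].Nodup)
    {a b c d : FreeGroup (Fin 2 ⊕ C)} (hab : ∀ r, exponent C r (a * b) = 1)
    (hcd : ∀ r, exponent C r (c * d) = 1) {n : ℕ} (ha : a.norm ≤ n) (hb : b.norm ≤ n)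
    (hc : c.norm ≤ n) (hd : d.norm ≤ n) :
    Near S (8812 * n ^ 2) (sect C i k l a * sect C j k l b * (sect C k i j c * sect C l i j d))
      (sect C k i j c * sect C l i j d * (sect C i k l a * sect C j k l b)) := by
  have hM : [k, l, i, j].Nodup := by grind
  obtain ⟨a', b', p, q, ha1, hb1, han, hbn, hp, hq, h1⟩ := near_sect_mul_sect hS h hab ha hb
  obtain ⟨c', d', p', q', hc1, hd1, hcn, hdn, hp', hq', h2⟩ :=
    near_sect_mul_sect hS hM hcd hc hd
  have hik : [i, k, l].Nodup := by grind
  have hjk : [j, k, l].Nodup := by grind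
  have hki : [k, i, j].Nodup := by grind
  have hli : [l, i, j].Nodup := by grind
  have e1 : i ≠ k := by grind
  have e2 : i ≠ l := by grind
  have e3 : j ≠ k := by grind
  have e4 : j ≠ l := by grind
  clear h hM hab hcd
  -- Each side splits into four pieces. The sixteen exchanges cost at most `61 * (3 * n) ^ 2` each
  -- and the two splittings `7 * n ^ 2`, each used twice: `16 * 549 + 4 * 7 = 8812`.
  refine (h1.comm_congr h2 (near_list_prod_comm (c := 549 * n ^ 2) _ _ ?_)).mono ?_
  · have e : 549 * n ^ 2 = 61 * (3 * n) ^ 2 := by ring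
    have hn : n ≤ 3 * n := by omega
    have hpp : ∀ (r s : Fin 2) (p q : ℤ), p.natAbs ≤ n → q.natAbs ≤ n →
        Near S (61 * (3 * n) ^ 2) (quot C r i j ^ p * quot C s k l ^ q)
          (quot C s k l ^ q * quot C r i j ^ p) := fun r s p q hp hq => by
      refine ((near_quot_comm_quot_of_ne hS r s e1 e2 e3 e4).comm_zpow p q).mono ?_
      have := Nat.mul_le_mul hp hq
      nlinarith
    rw [e]
    have kq : ∀ {i k l j j' : Fin 4} (_ : [i, k, l].Nodup) (_ : [i, j, j'].Nodup) (r : Fin 2)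
        {u : FreeGroup (Fin 2 ⊕ C)} (_ : ∀ r, exponent C r u = 1) (p : ℤ) (_ : u.norm ≤ 3 * n)
        (_ : p.natAbs ≤ n), Near S (61 * (3 * n) ^ 2) (sect C i k l u * quot C r j j' ^ p)
          (quot C r j j' ^ p * sect C i k l u) := fun h h' r _ hu p hun hpn =>
      near_kernel_comm_quot hS h h' r hu p hun (hpn.trans hn)
    simp only [List.mem_cons, List.not_mem_nil, or_false, forall_eq_or_imp, forall_eq]
    refine ⟨⟨?_, ?_, ?_, ?_⟩, ⟨?_, ?_, ?_, ?_⟩, ⟨?_, ?_, ?_, ?_⟩, ⟨?_, ?_, ?_, ?_⟩⟩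
    · exact near_kernel_comm_kernel hS e1 hik hki ha1 hc1 han hcn
    · exact kq hik hik _ ha1 _ han hq'
    · exact kq hik hik _ ha1 _ han hp'
    · exact near_kernel_comm_kernel hS e2 hik hli ha1 hd1 han hdn
    · exact (kq hki hki _ hc1 _ hcn hq).symm
    · exact hpp _ _ _ _ hq hq'
    · exact hpp _ _ _ _ hq hp'
    · exact (kq hli hli _ hd1 _ hdn hq).symm
    · exact (kq hki hki _ hc1 _ hcn hp).symm
    · exact hpp _ _ _ _ hp hq'
    · exact hpp _ _ _ _ hp hp'
    · exact (kq hli hli _ hd1 _ hdn hp).symm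
    · exact near_kernel_comm_kernel hS e3 hjk hki hb1 hc1 hbn hcn
    · exact kq hjk hjk _ hb1 _ hbn hq'
    · exact kq hjk hjk _ hb1 _ hbn hp'
    · exact near_kernel_comm_kernel hS e4 hjk hli hb1 hd1 hbn hdn
  · simp only [List.length_cons, List.length_nil]
    omega

theorem near_pair_mul (hS : shortRelators C ⊆ S) {i j k l : Fin 4} (h : [i, j, k, l].Nodup)
    {a b a' b' : FreeGroup (Fin 2 ⊕ C)} {n : ℕ} (hn : b.norm * a'.norm ≤ n) :
    Near S n (sect C i k l a * sect C j k l b * (sect C i k l a' * sect C j k l b'))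
      (sect C i k l (a * a') * sect C j k l (b * b')) := by
  have h1 := ((near_sect_comm_sect hS h a' b).symm.mul_left (sect C i k l a)).mul_right
    (sect C j k l b')
  simp only [mul_assoc, map_mul] at h1 ⊢
  exact h1.mono (by rwa [mul_comm])

variable {u v : Fin 4 → FreeGroup (Fin 2 ⊕ C)} {n : ℕ}

/-- A quotient of factors `0, 2` or `1, 3` can be read as a section from either end, which lets the
exponent correction cross from one half of the normal form to the other. -/
theorem near_gen_pair (hS : shortRelators C ⊆ S) (p q : ℤ) :
    Near S (p.natAbs + q.natAbs) (sect C 0 2 3 (gen C 0 ^ p) * sect C 1 2 3 (gen C 1 ^ q))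
      (sect C 2 0 1 (gen C 0 ^ (-p)) * sect C 3 0 1 (gen C 1 ^ (-q))) := by
  have h1 := ((near_quot_inv hS 0 0 2).zpow p).mul ((near_quot_inv hS 1 1 3).zpow q)
  simpa using h1

/-- The second half of `u` has to pass the first half of `v`. Absorbing the correction of `u` turns
its second half into `κu`, which has total exponents zero and is supported in factors `2, 3`; `κv`
is already supported in `0, 1` because the total exponents of `v` vanish. So `near_cross_comm`
applies. -/
theorem near_normalForm_mul (hS : shortRelators C ⊆ S)
    (hv : ∀ r, exponent C r (v 0 * v 1 * v 2 * v 3) = 1) (hun : ∀ m, (u m).norm ≤ n)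
    (hvn : ∀ m, (v m).norm ≤ n) :
    Near S (80000 * n ^ 2) (normalForm u * normalForm v) (normalForm (u * v)) := by
  have hL : [(0 : Fin 4), 1, 2, 3].Nodup := by decide
  have hM : [(2 : Fin 4), 3, 0, 1].Nodup := by decide
  have hexp : ∀ w : Fin 4 → FreeGroup (Fin 2 ⊕ C), (∀ m, (w m).norm ≤ n) → ∀ r,
      (exponent C r (w 2 * w 3)).toAdd.natAbs ≤ 2 * n := fun w hw r => by
    have h1 := natAbs_exponent_le r (w 2 * w 3)
    have h2 := FreeGroup.norm_mul_le (w 2) (w 3)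
    have h3 := hw 2
    have h4 := hw 3
    omega
  have hnn : n ≤ n ^ 2 := Nat.le_self_pow (by norm_num) n
  set P := (exponent C 0 (u 2 * u 3)).toAdd with hP
  set Q := (exponent C 1 (u 2 * u 3)).toAdd with hQ
  set P' := (exponent C 0 (v 2 * v 3)).toAdd with hP'
  set Q' := (exponent C 1 (v 2 * v 3)).toAdd with hQ'
  have bP : P.natAbs ≤ 2 * n := hexp u hun 0
  have bQ : Q.natAbs ≤ 2 * n := hexp u hun 1
  have bP' : P'.natAbs ≤ 2 * n := hexp v hvn 0
  have bQ' : Q'.natAbs ≤ 2 * n := hexp v hvn 1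
  have gP : ∀ r (s : ℤ), s.natAbs ≤ 2 * n → (gen C r ^ s).norm ≤ 2 * n := fun r s hs =>
    (norm_gen_zpow_le r s).trans hs
  have ml : ∀ {x y : FreeGroup (Fin 2 ⊕ C)} {s t : ℕ}, x.norm ≤ s → y.norm ≤ t →
      (x * y).norm ≤ s + t := fun hx hy =>
    (FreeGroup.norm_mul_le _ _).trans (Nat.add_le_add hx hy)
  -- `κu` and `κv` are the parts of the two normal forms that have to be exchanged
  let Λ := fun a b => sect C 0 2 3 a * sect C 1 2 3 b
  let M := fun a b => sect C 2 0 1 a * sect C 3 0 1 b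
  have mulΛ : ∀ (a b a' b' : FreeGroup (Fin 2 ⊕ C)) {s t : ℕ}, b.norm ≤ s → a'.norm ≤ t →
      Near S (s * t) (Λ a b * Λ a' b') (Λ (a * a') (b * b')) := fun a b a' b' _ _ h1 h2 =>
    near_pair_mul hS hL (Nat.mul_le_mul h1 h2)
  have mulM : ∀ (a b a' b' : FreeGroup (Fin 2 ⊕ C)) {s t : ℕ}, b.norm ≤ s → a'.norm ≤ t →
      Near S (s * t) (M a b * M a' b') (M (a * a') (b * b')) := fun a b a' b' _ _ h1 h2 =>
    near_pair_mul hS hM (Nat.mul_le_mul h1 h2)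
  let κu := M (gen C 0 ^ (-P) * u 2) (gen C 1 ^ (-Q) * u 3)
  let κv := Λ (v 0 * gen C 0 ^ P') (v 1 * gen C 1 ^ Q')
  have hκu : Near S (6 * n ^ 2) (Λ (gen C 0 ^ P) (gen C 1 ^ Q) * M (u 2) (u 3)) κu := by
    have h1 := (near_gen_pair hS P Q).mul_right (M (u 2) (u 3))
    have h2 := mulM (gen C 0 ^ (-P)) (gen C 1 ^ (-Q)) (u 2) (u 3) (gP 1 _ (by simpa)) (hun 2)
    refine (h1.trans h2).mono ?_
    nlinarith
  have hNu : Near S (8 * n ^ 2) (normalForm u) (Λ (u 0) (u 1) * κu) := by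
    have h1 := (mulΛ (u 0) (u 1) (gen C 0 ^ P) (gen C 1 ^ Q) (hun 1) (gP 0 _ bP)).symm.mul_right
      (M (u 2) (u 3))
    have h2 := hκu.mul_left (Λ (u 0) (u 1))
    rw [← mul_assoc] at h2
    exact (h1.trans h2).mono (by nlinarith)
  have hcomm : Near S (79308 * n ^ 2) (κu * κv) (κv * κu) := by
    -- Components of `κu` and `κv` have norm at most `n + 2 * n`: an original coordinate and a
    -- correcting power.
    have e : 79308 * n ^ 2 = 8812 * (3 * n) ^ 2 := by ring
    rw [e]
    refine (near_cross_comm hS hL ?_ ?_ ?_ ?_ ?_ ?_).symm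
    · have h := hv
      simp only [mul_assoc, map_mul] at h
      rw [Fin.forall_fin_two] at h ⊢
      constructor
      · rw [← h.1, hP']
        simp only [map_mul, exponent_gen_zpow, exponent_gen_zpow_of_ne one_ne_zero, if_true, mul_one]
        ac_rfl
      · rw [← h.2, hQ']
        simp only [map_mul, exponent_gen_zpow, exponent_gen_zpow_of_ne zero_ne_one, if_true, mul_one]
    · rw [Fin.forall_fin_two]
      constructor
      · rw [hP]
        simp only [map_mul, exponent_gen_zpow, exponent_gen_zpow_of_ne one_ne_zero, if_true,
          zpow_neg, map_inv, inv_one, one_mul]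
        group
      · rw [hQ]
        simp only [map_mul, exponent_gen_zpow, exponent_gen_zpow_of_ne zero_ne_one, if_true,
          zpow_neg, map_inv, inv_one, one_mul]
        rw [mul_left_comm, inv_mul_cancel]
    · exact (ml (hvn 0) (gP 0 _ bP')).trans (by omega)
    · exact (ml (hvn 1) (gP 1 _ bQ')).trans (by omega)
    · exact (ml (gP 0 _ (by simpa)) (hun 2)).trans (by omega)
    · exact (ml (gP 1 _ (by simpa)) (hun 3)).trans (by omega)
  have t1 := hNu.mul_right (normalForm v)
  have t2 := (hcomm.mul_left (Λ (u 0) (u 1))).mul_right (M (v 2) (v 3))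
  -- After the exchange `κu` is unfolded again, so that the correction of `u` can join that of `v`
  -- in factors `0` and `1`.
  have t3 := (mulΛ (u 0) (u 1) (v 0 * gen C 0 ^ P') (v 1 * gen C 1 ^ Q') (hun 1)
    (ml (hvn 0) (gP 0 _ bP'))).mul (hκu.symm.mul_right (M (v 2) (v 3)))
  have t4 := (mulΛ (u 0 * (v 0 * gen C 0 ^ P')) (u 1 * (v 1 * gen C 1 ^ Q')) (gen C 0 ^ P)
    (gen C 1 ^ Q) (ml (hun 1) (ml (hvn 1) (gP 1 _ bQ'))) (gP 0 _ bP)).mul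
    (mulM (u 2) (u 3) (v 2) (v 3) (hun 3) (hvn 2))
  have e1 : Λ (u 0) (u 1) * κu * normalForm v =
      Λ (u 0) (u 1) * (κu * κv) * M (v 2) (v 3) := by
    simp only [normalForm, κv, Λ, M, mul_assoc, hP', hQ']
  have e2 : Λ (u 0) (u 1) * (κv * κu) * M (v 2) (v 3) =
      Λ (u 0) (u 1) * κv * (κu * M (v 2) (v 3)) := by
    simp only [mul_assoc]
  have e3 : Λ (u 0 * (v 0 * gen C 0 ^ P')) (u 1 * (v 1 * gen C 1 ^ Q')) *
      (Λ (gen C 0 ^ P) (gen C 1 ^ Q) * M (u 2) (u 3) * M (v 2) (v 3)) =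
      Λ (u 0 * (v 0 * gen C 0 ^ P')) (u 1 * (v 1 * gen C 1 ^ Q')) *
      Λ (gen C 0 ^ P) (gen C 1 ^ Q) * (M (u 2) (u 3) * M (v 2) (v 3)) := by
    simp only [mul_assoc]
  have e4 : Λ (u 0 * (v 0 * gen C 0 ^ P') * gen C 0 ^ P)
      (u 1 * (v 1 * gen C 1 ^ Q') * gen C 1 ^ Q) * M (u 2 * v 2) (u 3 * v 3) =
      normalForm (u * v) := by
    have h1 : P' + P = (exponent C 0 ((u * v) 2 * (u * v) 3)).toAdd := by
      simp [hP, hP']; ring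
    have h2 : Q' + Q = (exponent C 1 ((u * v) 2 * (u * v) 3)).toAdd := by
      simp [hQ, hQ']; ring
    rw [normalForm, ← h1, ← h2, zpow_add, zpow_add]
    simp only [Λ, M, Pi.mul_apply, mul_assoc]
  rw [e1] at t1
  rw [e2] at t2
  rw [e3] at t3
  rw [e4] at t4
  exact (((t1.trans t2).trans t3).trans t4).mono (by nlinarith)

theorem norm_normalForm_le (hv : ∀ m, (v m).norm ≤ n) : (normalForm v).norm ≤ 8 * n := by
  have h0 := hv 0
  have h1 := hv 1
  have h2 := hv 2
  have h3 := hv 3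
  have a1 := FreeGroup.norm_mul_le
    (sect C 0 2 3 (v 0 * gen C 0 ^ (exponent C 0 (v 2 * v 3)).toAdd) *
    sect C 1 2 3 (v 1 * gen C 1 ^ (exponent C 1 (v 2 * v 3)).toAdd))
    (sect C 2 0 1 (v 2) * sect C 3 0 1 (v 3))
  have a2 := FreeGroup.norm_mul_le
    (sect C 0 2 3 (v 0 * gen C 0 ^ (exponent C 0 (v 2 * v 3)).toAdd))
    (sect C 1 2 3 (v 1 * gen C 1 ^ (exponent C 1 (v 2 * v 3)).toAdd))
  have a3 := FreeGroup.norm_mul_le (sect C 2 0 1 (v 2)) (sect C 3 0 1 (v 3))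
  have a4 := norm_sect_le 2 0 1 (v 2)
  have a5 := norm_sect_le 3 0 1 (v 3)
  have a6 := norm_sect_le 0 2 3 (v 0 * gen C 0 ^ (exponent C 0 (v 2 * v 3)).toAdd)
  have a7 := norm_sect_le 1 2 3 (v 1 * gen C 1 ^ (exponent C 1 (v 2 * v 3)).toAdd)
  have a8 := FreeGroup.norm_mul_le (v 0) (gen C 0 ^ (exponent C 0 (v 2 * v 3)).toAdd)
  have a9 := FreeGroup.norm_mul_le (v 1) (gen C 1 ^ (exponent C 1 (v 2 * v 3)).toAdd)
  have a10 := FreeGroup.norm_mul_le (v 2) (v 3)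
  have b0 := (norm_gen_zpow_le (C := C) 0 _).trans (natAbs_exponent_le 0 (v 2 * v 3))
  have b1 := (norm_gen_zpow_le (C := C) 1 _).trans (natAbs_exponent_le 1 (v 2 * v 3))
  rw [normalForm]
  omega

/-- Every word can be brought into normal form at quadratic cost. -/
theorem near_normalForm (hS : shortRelators C ⊆ S) (w : FreeGroup (KerGen C)) :
    Near S (1000000 * w.norm ^ 2) w (normalForm fun m => coord C m w) := by
  have hexp : ∀ (w : FreeGroup (KerGen C)) r,
      exponent C r (coord C 0 w * coord C 1 w * coord C 2 w * coord C 3 w) = 1 := fun w r => by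
    simpa using exponent_coord_prod r w
  have key : ∀ (n : ℕ) (w : List (KerGen C × Bool)), w.length = n →
      Near S (1000000 * n ^ 2) (FreeGroup.mk w)
        (normalForm fun m => coord C m (FreeGroup.mk w)) := by
    intro n
    induction n using Nat.strong_induction_on with
    | _ n ih =>
    intro w hw
    have hnw : ∀ m (w' : List (KerGen C × Bool)), w'.length ≤ n →
        (coord C m (FreeGroup.mk w')).norm ≤ 2 * n := fun m w' h =>
      (norm_coord_le m _).trans (Nat.mul_le_mul_left 2 (FreeGroup.norm_mk_le.trans h))
    rcases Nat.lt_or_ge n 2 with hn | hn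
    · rcases Nat.eq_zero_or_pos n with rfl | hpos
      · obtain rfl : w = [] := by simpa using hw
        refine near_of_eq ?_ _
        simp [← FreeGroup.one_eq_mk, normalForm]
      · obtain rfl : n = 1 := by omega
        refine (near_of_coord hS ?_ fun m => (coord_normalForm
          (v := fun m => coord C m (FreeGroup.mk w)) (hexp _) m).symm).mono (by norm_num)
        have h1 := norm_normalForm_le (v := fun m => coord C m (FreeGroup.mk w)) fun m => hnw m w hw.le
        have h2 := FreeGroup.norm_mk_le (L₁ := w)
        omega
    -- Halving makes the merging costs sum geometrically; applying `near_normalForm_mul` once per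
    -- letter would give a cubic bound. Coordinates have norm at most `2 * n`, so merging costs
    -- `320000 * n ^ 2`, and the two halves about `500000 * n ^ 2`.
    · have hsplit := List.take_append_drop (n / 2) w
      set w₁ := w.take (n / 2) with hw₁
      set w₂ := w.drop (n / 2) with hw₂
      have l₁ : w₁.length = n / 2 := by rw [hw₁, List.length_take, hw]; omega
      have l₂ : w₂.length = n - n / 2 := by rw [hw₂, List.length_drop, hw]
      have h1 := ih _ (by omega) w₁ l₁
      have h2 := ih _ (by omega) w₂ l₂
      have h3 := near_normalForm_mul hS
        (u := fun m => coord C m (FreeGroup.mk w₁)) (v := fun m => coord C m (FreeGroup.mk w₂))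
        (hexp (FreeGroup.mk w₂))
        (fun m => hnw m w₁ (by omega)) (fun m => hnw m w₂ (by omega))
      have h4 := (h1.mul h2).trans h3
      have e : ((fun m => coord C m (FreeGroup.mk w₁)) * fun m => coord C m (FreeGroup.mk w₂)) =
          fun m => coord C m (FreeGroup.mk w) := by
        funext m
        rw [Pi.mul_apply, ← map_mul, FreeGroup.mul_mk, hsplit]
      rw [e, FreeGroup.mul_mk, hsplit] at h4
      refine h4.mono ?_
      generalize hb : n - n / 2 = b
      generalize ha : n / 2 = a at hb
      obtain rfl : n = a + b := by omega
      have h5 : b = a ∨ b = a + 1 := by omega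
      have h6 : 1 ≤ a := by omega
      clear * - h5 h6
      rcases h5 with rfl | rfl <;> nlinarith
  have := key _ w.toWord rfl
  rwa [FreeGroup.mk_toWord] at this

end Kernel


/-! ### Direct products of four groups -/

section Product

variable {A : Type*}

/-- The inclusion of the `i`-th factor. -/
def incl (A : Type*) (i : Fin 4) : FreeGroup A →* FreeGroup (Fin 4 × A) :=
  FreeGroup.map fun a => (i, a)

/-- The projection to the `m`-th factor. -/
def proj (A : Type*) (m : Fin 4) : FreeGroup (Fin 4 × A) →* FreeGroup A :=
  FreeGroup.lift fun x => if x.1 = m then FreeGroup.of x.2 else 1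

/-- The relators of the factors, together with commutators of generators of different factors. -/
def prodRelators (R : Fin 4 → Set (FreeGroup A)) : Set (FreeGroup (Fin 4 × A)) :=
  (⋃ i, incl A i '' R i) ∪ Set.range fun x : (Fin 4 × A) × (Fin 4 × A) =>
    if x.1.1 = x.2.1 then 1 else FreeGroup.of x.1 * FreeGroup.of x.2 *
      (FreeGroup.of x.2 * FreeGroup.of x.1)⁻¹

/-- The product of elements of the four factors. -/
def prodWord (v : Fin 4 → FreeGroup A) : FreeGroup (Fin 4 × A) :=
  incl A 0 (v 0) * incl A 1 (v 1) * incl A 2 (v 2) * incl A 3 (v 3)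

theorem proj_incl (m i : Fin 4) (v : FreeGroup A) :
    proj A m (incl A i v) = if i = m then v else 1 := by
  split_ifs with h
  · refine DFunLike.congr_fun (f := (proj A m).comp (incl A i)) (g := MonoidHom.id _) ?_ v
    ext a
    simp [proj, incl, h]
  · refine DFunLike.congr_fun (f := (proj A m).comp (incl A i)) (g := 1) ?_ v
    ext a
    simp [proj, incl, h]

theorem proj_prodWord (m : Fin 4) (v : Fin 4 → FreeGroup A) : proj A m (prodWord v) = v m := by
  simp only [prodWord, map_mul, proj_incl]
  fin_cases m <;> simp

theorem finite_prodRelators [Finite A] {R : Fin 4 → Set (FreeGroup A)} (hR : ∀ i, (R i).Finite) :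
    (prodRelators R).Finite :=
  (Set.finite_iUnion fun i => (hR i).image _).union (Set.finite_range _)

variable {R : Fin 4 → Set (FreeGroup A)}

theorem proj_mem_normalClosure {w : FreeGroup (Fin 4 × A)}
    (hw : w ∈ Subgroup.normalClosure (prodRelators R)) (m : Fin 4) :
    proj A m w ∈ Subgroup.normalClosure (R m) := by
  have : Subgroup.normalClosure (prodRelators R) ≤
      (Subgroup.normalClosure (R m)).comap (proj A m) := by
    refine Subgroup.normalClosure_le_normal ?_
    rintro _ (hr | ⟨⟨⟨i, a⟩, ⟨j, b⟩⟩, rfl⟩)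
    · obtain ⟨i, r, hri, rfl⟩ := Set.mem_iUnion.1 hr
      simp only [SetLike.mem_coe, Subgroup.mem_comap, proj_incl]
      split_ifs with h
      · subst h
        exact Subgroup.subset_normalClosure hri
      · exact one_mem _
    · simp only [SetLike.mem_coe, Subgroup.mem_comap]
      split_ifs with h
      · rw [map_one]
        exact one_mem _
      · have : proj A m (FreeGroup.of (i, a) * FreeGroup.of (j, b) *
            (FreeGroup.of (j, b) * FreeGroup.of (i, a))⁻¹) = 1 := by
          by_cases h1 : i = m
          · subst h1
            simp [proj, Ne.symm h]
          · simp [proj, h1]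
        rw [this]
        exact one_mem _
  exact this hw

variable [DecidableEq A]

theorem norm_proj_le (m : Fin 4) (w : FreeGroup (Fin 4 × A)) : (proj A m w).norm ≤ w.norm := by
  refine (norm_map_le (c := 1) _ (fun a => ?_) w).trans (by simp)
  simp only [proj, FreeGroup.lift_apply_of]
  split_ifs <;> simp

theorem near_incl_comm {i j : Fin 4} (hij : i ≠ j) (u v : FreeGroup A) :
    Near (prodRelators R) (u.norm * v.norm) (incl A i u * incl A j v)
      (incl A j v * incl A i u) := by
  have := near_comm_map (T := prodRelators R) (c := 1) (incl A i) (incl A j) (fun a b => ?_) u v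
  · simpa using this
  · refine near_of_mem (Or.inr ⟨((i, a), (j, b)), ?_⟩)
    simp [incl, hij]

/-- The `6` counts the pairs `i > j` for which `u i` has to pass `v j`. -/
theorem near_prodWord_mul {u v : Fin 4 → FreeGroup A} {s t : ℕ} (hu : ∀ m, (u m).norm ≤ s)
    (hv : ∀ m, (v m).norm ≤ t) :
    Near (prodRelators R) (6 * (s * t)) (prodWord u * prodWord v) (prodWord (u * v)) := by
  have c : ∀ i j, i ≠ j → Near (prodRelators R) (s * t) (incl A i (u i) * incl A j (v j))
      (incl A j (v j) * incl A i (u i)) := fun i j hij =>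
    (near_incl_comm hij (u i) (v j)).mono (Nat.mul_le_mul (hu i) (hv j))
  have c0 := ((c 1 0 (by decide)).comm_mul_left (c 2 0 (by decide))).comm_mul_left
    (c 3 0 (by decide))
  have c1 := (c 2 1 (by decide)).comm_mul_left (c 3 1 (by decide))
  have c2 := c 3 2 (by decide)
  have h0 := (c0.mul_left (incl A 0 (u 0))).mul_right
    (incl A 1 (v 1) * (incl A 2 (v 2) * incl A 3 (v 3)))
  have h1 := (c1.mul_left (incl A 0 (u 0) * incl A 0 (v 0) * incl A 1 (u 1))).mul_right
    (incl A 2 (v 2) * incl A 3 (v 3))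
  have h2 := (c2.mul_left (incl A 0 (u 0) * incl A 0 (v 0) * incl A 1 (u 1) * incl A 1 (v 1) *
    incl A 2 (u 2))).mul_right (incl A 3 (v 3))
  simp only [mul_assoc] at h0 h1 h2
  simp only [prodWord, Pi.mul_apply, map_mul, mul_assoc]
  exact ((h0.trans h1).trans h2).mono (by omega)

/-- Collecting one letter at a time suffices here, since a single letter is absorbed at linear cost.
-/
theorem near_prodWord (w : FreeGroup (Fin 4 × A)) :
    Near (prodRelators R) (6 * w.norm ^ 2) w (prodWord fun m => proj A m w) := by
  have key : ∀ w : List ((Fin 4 × A) × Bool), Near (prodRelators R) (6 * w.length ^ 2)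
      (FreeGroup.mk w) (prodWord fun m => proj A m (FreeGroup.mk w)) := by
    intro w
    induction w with
    | nil => exact near_of_eq (by simp [prodWord, ← FreeGroup.one_eq_mk]) _
    | cons x w ih =>
      have hx : FreeGroup.mk [x] = prodWord fun m => proj A m (FreeGroup.mk [x]) := by
        have hof : ∀ y : Fin 4 × A, FreeGroup.of y =
            prodWord fun m => proj A m (FreeGroup.of y) := by
          rintro ⟨i, a⟩
          fin_cases i <;> simp [prodWord, proj, incl]
        obtain ⟨⟨i, a⟩, _ | _⟩ := x
        · rw [mk_singleton_false]
          fin_cases i <;> simp [prodWord, proj, incl]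
        · exact hof (i, a)
      have h1 := near_prodWord_mul (R := R) (u := fun m => proj A m (FreeGroup.mk [x]))
        (v := fun m => proj A m (FreeGroup.mk w)) (s := 1) (t := w.length)
        (fun m => (norm_proj_le m _).trans FreeGroup.norm_mk_le)
        (fun m => (norm_proj_le m _).trans FreeGroup.norm_mk_le)
      rw [← hx] at h1
      have h2 := (ih.mul_left (FreeGroup.mk [x])).trans h1
      have e : ((fun m => proj A m (FreeGroup.mk [x])) * fun m => proj A m (FreeGroup.mk w)) =
          fun m => proj A m (FreeGroup.mk (x :: w)) := by
        funext m
        rw [Pi.mul_apply, ← map_mul, ← mk_cons_eq]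
      rw [e, ← mk_cons_eq] at h2
      refine h2.mono ?_
      rw [List.length_cons]
      nlinarith
  have := key w.toWord
  rwa [FreeGroup.mk_toWord] at this

theorem near_one_of_proj [Finite A] {w : FreeGroup (Fin 4 × A)} {n : ℕ} (hn : w.norm ≤ n)
    (hw : ∀ m, proj A m w ∈ Subgroup.normalClosure (R m)) :
    Near (prodRelators R) (6 * n ^ 2 + (dehnFunction (R 0) n + dehnFunction (R 1) n +
      dehnFunction (R 2) n + dehnFunction (R 3) n)) w 1 := by
  have h : ∀ m, Near (prodRelators R) (dehnFunction (R m) n) (incl A m (proj A m w)) 1 := by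
    intro m
    have h1 := (near_dehnFunction (hw m) ((norm_proj_le m w).trans hn)).map (T := prodRelators R)
      (c := 1) (incl A m) fun r hr => near_of_mem (Or.inl (Set.mem_iUnion.2 ⟨m, r, hr, by simp⟩))
    simpa using h1
  have h2 := (((h 0).mul (h 1)).mul (h 2)).mul (h 3)
  have h3 := (near_prodWord (R := R) w).mono (Nat.mul_le_mul_left 6 (Nat.pow_le_pow_left hn 2))
  simpa [prodWord] using h3.trans h2

theorem mem_normalClosure_prodRelators [Finite A] {w : FreeGroup (Fin 4 × A)} :
    w ∈ Subgroup.normalClosure (prodRelators R) ↔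
      ∀ m, proj A m w ∈ Subgroup.normalClosure (R m) :=
  ⟨proj_mem_normalClosure, fun h => near_one_iff.1 ⟨_, near_one_of_proj le_rfl h⟩⟩

theorem dehnFunction_prodRelators_le [Finite A] (n : ℕ) :
    dehnFunction (prodRelators R) n ≤ 6 * n ^ 2 + (dehnFunction (R 0) n + dehnFunction (R 1) n +
      dehnFunction (R 2) n + dehnFunction (R 3) n) :=
  dehnFunction_le fun _ hg hn => near_one_of_proj hn fun m => proj_mem_normalClosure hg m

omit [DecidableEq A] in
theorem dominated_prodRelators [Finite A] (hR : ∀ i, (R i).Finite) (m : Fin 4) :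
    Dominated (dehnFunction (R m)) (dehnFunction (prodRelators R)) := by
  refine dominated_of_retract (finite_prodRelators hR) (incl A m) (proj A m) ?_ ?_ ?_
  · intro r hr
    exact Subgroup.subset_normalClosure (Or.inl (Set.mem_iUnion.2 ⟨m, r, hr, rfl⟩))
  · intro r hr
    exact proj_mem_normalClosure (Subgroup.subset_normalClosure hr) m
  · intro a
    simp [proj_incl]

end Product

/-! ### Kernels of homomorphisms to `ℤ²` -/

section KernelPresentation

variable {C : Type*} [DecidableEq C] {R : Fin 4 → Set (FreeGroup (Fin 2 ⊕ C))}

/-- The sections of the projections that occur in normal forms. -/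
def baseSect (C : Type*) : Fin 4 → FreeGroup (Fin 2 ⊕ C) →* FreeGroup (KerGen C) :=
  ![sect C 0 2 3, sect C 1 2 3, sect C 2 0 1, sect C 3 0 1]

/-- The relators of the kernel. -/
def kerRelators (R : Fin 4 → Set (FreeGroup (Fin 2 ⊕ C))) : Set (FreeGroup (KerGen C)) :=
  shortRelators C ∪ ⋃ i, baseSect C i '' R i

theorem finite_kerRelators [Finite C] (hR : ∀ i, (R i).Finite) : (kerRelators R).Finite :=
  ((finite_norm_le 30).subset fun _ hg => hg.1).union
    (Set.finite_iUnion fun i => (hR i).image _)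

omit [DecidableEq C] in
theorem coord_baseSect {v : FreeGroup (Fin 2 ⊕ C)} (hv : ∀ r, exponent C r v = 1) (m i : Fin 4) :
    coord C m (baseSect C i v) = if m = i then v else 1 := by
  have h0 : [(0 : Fin 4), 2, 3].Nodup := by decide
  have h1 : [(1 : Fin 4), 2, 3].Nodup := by decide
  have h2 : [(2 : Fin 4), 0, 1].Nodup := by decide
  have h3 : [(3 : Fin 4), 0, 1].Nodup := by decide
  fin_cases i
  · simp [baseSect, coord_sect m h0, hv]
  · simp [baseSect, coord_sect m h1, hv]
  · simp [baseSect, coord_sect m h2, hv]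
  · simp [baseSect, coord_sect m h3, hv]

omit [DecidableEq C] in
theorem exponent_eq_one_of_mem (hexp : ∀ i, ∀ r ∈ R i, ∀ s, exponent C s r = 1) {m : Fin 4}
    {v : FreeGroup (Fin 2 ⊕ C)} (hv : v ∈ Subgroup.normalClosure (R m)) (s : Fin 2) :
    exponent C s v = 1 := by
  have : Subgroup.normalClosure (R m) ≤ (exponent C s).ker :=
    Subgroup.normalClosure_le_normal fun r hr => hexp m r hr s
  exact this hv

theorem coord_mem_normalClosure (hexp : ∀ i, ∀ r ∈ R i, ∀ s, exponent C s r = 1)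
    {w : FreeGroup (KerGen C)} (hw : w ∈ Subgroup.normalClosure (kerRelators R)) (m : Fin 4) :
    coord C m w ∈ Subgroup.normalClosure (R m) := by
  have : Subgroup.normalClosure (kerRelators R) ≤
      (Subgroup.normalClosure (R m)).comap (coord C m) := by
    refine Subgroup.normalClosure_le_normal ?_
    rintro r (hr | hr)
    · simp only [SetLike.mem_coe, Subgroup.mem_comap, hr.2 m]
      exact one_mem _
    · obtain ⟨i, r, hri, rfl⟩ := Set.mem_iUnion.1 hr
      simp only [SetLike.mem_coe, Subgroup.mem_comap, coord_baseSect (hexp i r hri)]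
      split_ifs with h
      · subst h
        exact Subgroup.subset_normalClosure hri
      · exact one_mem _
  exact this hw

/-- The coordinates have exponent zero, so the corrections in the normal form disappear and a
product of sections remains. Each is filled by transporting a filling over `R m` along `baseSect C
m`; `2 * n` bounds the norm of a coordinate. -/
theorem near_one_of_coord [Finite C] (hexp : ∀ i, ∀ r ∈ R i, ∀ s, exponent C s r = 1)
    {w : FreeGroup (KerGen C)} {n : ℕ} (hn : w.norm ≤ n)
    (hw : ∀ m, coord C m w ∈ Subgroup.normalClosure (R m)) :
    Near (kerRelators R) (1000000 * n ^ 2 + (dehnFunction (R 0) (2 * n) +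
      dehnFunction (R 1) (2 * n) + dehnFunction (R 2) (2 * n) + dehnFunction (R 3) (2 * n)))
      w 1 := by
  have h : ∀ m, Near (kerRelators R) (dehnFunction (R m) (2 * n))
      (baseSect C m (coord C m w)) 1 := by
    intro m
    have h1 := (near_dehnFunction (hw m) ((norm_coord_le m w).trans
      (Nat.mul_le_mul_left 2 hn))).map (T := kerRelators R) (c := 1) (baseSect C m)
      fun r hr => near_of_mem (Or.inr (Set.mem_iUnion.2 ⟨m, r, hr, by simp⟩))
    simpa using h1
  have h2 := ((h 0).mul (h 1)).mul ((h 2).mul (h 3))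
  have h3 := (near_normalForm (S := kerRelators R) Set.subset_union_left w).mono
    (Nat.mul_le_mul_left 1000000 (Nat.pow_le_pow_left hn 2))
  have e : (normalForm fun m => coord C m w) =
      baseSect C 0 (coord C 0 w) * baseSect C 1 (coord C 1 w) *
        (baseSect C 2 (coord C 2 w) * baseSect C 3 (coord C 3 w)) := by
    have e2 := exponent_eq_one_of_mem hexp (hw 2)
    have e3 := exponent_eq_one_of_mem hexp (hw 3)
    simp [normalForm, baseSect, e2, e3]
  rw [e] at h3
  have h4 := h3.trans h2
  rw [mul_one, mul_one] at h4
  exact h4.mono (by omega)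

theorem mem_normalClosure_kerRelators [Finite C]
    (hexp : ∀ i, ∀ r ∈ R i, ∀ s, exponent C s r = 1) {w : FreeGroup (KerGen C)} :
    w ∈ Subgroup.normalClosure (kerRelators R) ↔
      ∀ m, coord C m w ∈ Subgroup.normalClosure (R m) :=
  ⟨coord_mem_normalClosure hexp, fun h => near_one_iff.1 ⟨_, near_one_of_coord hexp le_rfl h⟩⟩

theorem dehnFunction_kerRelators_le [Finite C]
    (hexp : ∀ i, ∀ r ∈ R i, ∀ s, exponent C s r = 1) (n : ℕ) :
    dehnFunction (kerRelators R) n ≤ 1000000 * n ^ 2 + (dehnFunction (R 0) (2 * n) +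
      dehnFunction (R 1) (2 * n) + dehnFunction (R 2) (2 * n) + dehnFunction (R 3) (2 * n)) :=
  dehnFunction_le fun _ hg hn => near_one_of_coord hexp hn fun m => coord_mem_normalClosure hexp hg m

/-- The section `baseSect C m` respects the relators and is split by the coordinate map, so the
factor is a retract of the kernel. -/
theorem dominated_kerRelators [Finite C] (hR : ∀ i, (R i).Finite)
    (hexp : ∀ i, ∀ r ∈ R i, ∀ s, exponent C s r = 1) (m : Fin 4) :
    Dominated (dehnFunction (R m)) (dehnFunction (kerRelators R)) := by
  have hcs : ∀ v, coord C m (baseSect C m v) = v := by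
    have h0 : [(0 : Fin 4), 2, 3].Nodup := by decide
    have h1 : [(1 : Fin 4), 2, 3].Nodup := by decide
    have h2 : [(2 : Fin 4), 0, 1].Nodup := by decide
    have h3 : [(3 : Fin 4), 0, 1].Nodup := by decide
    intro v
    fin_cases m
    · exact (coord_sect 0 h0 v).trans (if_pos rfl)
    · exact (coord_sect 1 h1 v).trans (if_pos rfl)
    · exact (coord_sect 2 h2 v).trans (if_pos rfl)
    · exact (coord_sect 3 h3 v).trans (if_pos rfl)
  refine dominated_of_retract (finite_kerRelators hR) (baseSect C m) (coord C m) ?_ ?_ ?_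
  · intro r hr
    exact Subgroup.subset_normalClosure (Or.inr (Set.mem_iUnion.2 ⟨m, r, hr, rfl⟩))
  · intro r hr
    exact coord_mem_normalClosure hexp (Subgroup.subset_normalClosure hr) m
  · intro a
    rw [hcs, mul_inv_cancel]
    exact one_mem _

/-- Quotients of `x₀` in factors `0, 1` and of `x₁` in factors `2, 3` commute, and are detected by
exponents in factors `0` and `2`. -/
theorem dominated_sq_kerRelators [Finite C] (hR : ∀ i, (R i).Finite)
    (hexp : ∀ i, ∀ r ∈ R i, ∀ s, exponent C s r = 1) :
    Dominated (fun n => n ^ 2) (dehnFunction (kerRelators R)) := by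
  have hp : ∀ (s : Fin 2) (m : Fin 4), ∀ r ∈ kerRelators R,
      ((exponent C s).comp (coord C m)) r = 1 := fun s m r hr =>
    exponent_eq_one_of_mem hexp
      (coord_mem_normalClosure hexp (Subgroup.subset_normalClosure hr) m) s
  refine dominated_sq (finite_kerRelators hR) _ _ (hp 0 0) (hp 1 2) (quot C 0 0 1) (quot C 1 2 3)
    ?_ ?_ ?_ ?_ ?_
  · have h := near_quot_comm_quot_of_ne (S := kerRelators R) Set.subset_union_left 0 1
      (i := 0) (j := 1) (k := 2) (l := 3) (by decide) (by decide) (by decide) (by decide)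
    have h1 := h.mul_right (quot C 1 2 3 * quot C 0 0 1)⁻¹
    rw [mul_inv_cancel] at h1
    rw [← mul_inv_eq_one, ← map_inv, ← map_mul, mk_eq_one_iff_mem]
    exact near_one_iff.1 ⟨_, h1⟩
  all_goals simp [coord_quot]

theorem dominated_sq_prodRelators [Finite C] (hR : ∀ i, (R i).Finite)
    (hexp : ∀ i, ∀ r ∈ R i, ∀ s, exponent C s r = 1) :
    Dominated (fun n => n ^ 2) (dehnFunction (prodRelators R)) := by
  have hp : ∀ (s : Fin 2) (m : Fin 4), ∀ r ∈ prodRelators R,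
      ((exponent C s).comp (proj _ m)) r = 1 := fun s m r hr =>
    exponent_eq_one_of_mem hexp (proj_mem_normalClosure (Subgroup.subset_normalClosure hr) m) s
  refine dominated_sq (finite_prodRelators hR) _ _ (hp 0 0) (hp 1 1) (incl _ 0 (gen C 0))
    (incl _ 1 (gen C 1)) ?_ ?_ ?_ ?_ ?_
  · have h1 := (near_incl_comm (R := R) (i := 0) (j := 1) (by decide) (gen C 0)
      (gen C 1)).mul_right (incl _ 1 (gen C 1) * incl _ 0 (gen C 0))⁻¹
    rw [mul_inv_cancel] at h1
    rw [← mul_inv_eq_one, ← map_inv, ← map_mul, mk_eq_one_iff_mem]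
    exact near_one_iff.1 ⟨_, h1⟩
  all_goals simp [proj_incl]

/-- The product and the kernel have equivalent Dehn functions. -/
theorem dominated_prodRelators_kerRelators [Finite C] (hR : ∀ i, (R i).Finite)
    (hexp : ∀ i, ∀ r ∈ R i, ∀ s, exponent C s r = 1) :
    Dominated (dehnFunction (prodRelators R)) (dehnFunction (kerRelators R)) := by
  have hm : Monotone (dehnFunction (kerRelators R)) := dehnFunction_mono
  have h := dominated_kerRelators hR hexp
  exact (Dominated.of_le dehnFunction_prodRelators_le).trans hm
    (((dominated_sq_kerRelators hR hexp).const_mul hm 6).add hm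
      ((((h 0).add hm (h 1)).add hm (h 2)).add hm (h 3)))

theorem dominated_kerRelators_prodRelators [Finite C] (hR : ∀ i, (R i).Finite)
    (hexp : ∀ i, ∀ r ∈ R i, ∀ s, exponent C s r = 1) :
    Dominated (dehnFunction (kerRelators R)) (dehnFunction (prodRelators R)) := by
  have hm : Monotone (dehnFunction (prodRelators R)) := dehnFunction_mono
  have h := fun m => (dominated_prodRelators hR m).comp_mul hm 2
  exact (Dominated.of_le (dehnFunction_kerRelators_le hexp)).trans hm
    (((dominated_sq_prodRelators hR hexp).const_mul hm 1000000).add hm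
      ((((h 0).add hm (h 1)).add hm (h 2)).add hm (h 3)))

end KernelPresentation


/-! ### Adapted generators and real asymptotics -/

/-- A finitely presented group with a surjection `φ` to `ℤ²` has generators of which the first two
map to the standard basis and the others to zero. -/
theorem exists_adapted_generators {G : Type*} [Group G] (hG : Group.IsFinitelyPresented G)
    (φ : G →* Multiplicative (Fin 2 → ℤ)) (hφ : Function.Surjective φ) :
    ∃ n : ℕ, ∀ N ≥ n, ∃ ψ : FreeGroup (Fin 2 ⊕ Fin N) →* G, Function.Surjective ψ ∧
      ∀ v, φ (ψ v) = Multiplicative.ofAdd fun r => (exponent (Fin N) r v).toAdd := by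
  obtain ⟨n, π, hπ, -⟩ := hG.out
  refine ⟨n, fun N hN => ?_⟩
  choose g hg using fun r : Fin 2 => hφ (Multiplicative.ofAdd (Pi.single r 1))
  -- Padding by trivial generators allows a common `N` for all four factors. Dividing `y c` by `t (y
  -- c)`, a product of powers of `g 0` and `g 1` with the same image, moves it into the kernel.
  let y : Fin N → G := fun c => if h : c.1 < n then π (FreeGroup.of ⟨c, h⟩) else 1
  let t : G → G := fun a => g 0 ^ (φ a).toAdd 0 * g 1 ^ (φ a).toAdd 1
  have ht : ∀ a, φ (t a) = φ a := by
    intro a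
    apply Multiplicative.toAdd.injective
    funext r
    fin_cases r <;> simp [t, hg]
  let ψ : FreeGroup (Fin 2 ⊕ Fin N) →* G :=
    FreeGroup.lift (Sum.elim g fun c => y c * (t (y c))⁻¹)
  have hrange : ∀ a ∈ Set.range y, a ∈ ψ.range := by
    have h1 : ∀ r, g r ∈ ψ.range := fun r => ⟨FreeGroup.of (Sum.inl r), by simp [ψ]⟩
    rintro _ ⟨c, rfl⟩
    have h2 : t (y c) ∈ ψ.range := mul_mem (zpow_mem (h1 0) _) (zpow_mem (h1 1) _)
    have h3 : y c * (t (y c))⁻¹ ∈ ψ.range := ⟨FreeGroup.of (Sum.inr c), by simp [ψ]⟩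
    simpa using mul_mem h3 h2
  refine ⟨ψ, fun a => ?_, ?_⟩
  · obtain ⟨w, rfl⟩ := hπ a
    change π w ∈ ψ.range
    have hof : ∀ i : Fin n, π (FreeGroup.of i) ∈ ψ.range := fun i =>
      hrange _ ⟨⟨i, i.2.trans_le hN⟩, by simp [y]⟩
    induction w using FreeGroup.induction_on with
    | C1 => simp
    | of i => exact hof i
    | inv_of i _ => rw [map_inv]; exact inv_mem (hof i)
    | mul u v hu hv => rw [map_mul]; exact mul_mem hu hv
  · let e : FreeGroup (Fin 2 ⊕ Fin N) →* Multiplicative (Fin 2 → ℤ) :=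
      { toFun := fun v => Multiplicative.ofAdd fun r => (exponent (Fin N) r v).toAdd
        map_one' := by
          apply Multiplicative.toAdd.injective
          funext r
          simp
        map_mul' := fun u v => by
          apply Multiplicative.toAdd.injective
          funext r
          simp }
    refine DFunLike.congr_fun (f := φ.comp ψ) (g := e) ?_
    ext a : 1
    apply Multiplicative.toAdd.injective
    funext s
    rcases a with r | c
    · fin_cases r <;> fin_cases s <;> simp [ψ, e, hg, exponent]
    · simp [ψ, e, ht]

theorem map_eq_prod_four {G : Fin 4 → Type*} [∀ i, Group (G i)] {H : Type*} [Group H]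
    (φ : (∀ i, G i) →* H) (f : ∀ i, G i) :
    φ f = φ.comp (MonoidHom.mulSingle G 0) (f 0) * φ.comp (MonoidHom.mulSingle G 1) (f 1) *
      φ.comp (MonoidHom.mulSingle G 2) (f 2) * φ.comp (MonoidHom.mulSingle G 3) (f 3) := by
  simp only [MonoidHom.comp_apply, ← map_mul]
  congr 1
  funext i
  fin_cases i <;> simp [Pi.mulSingle]

theorem Dominated.asympLE {f g : ℕ → ℕ} (hg : Monotone g) (h : Dominated f g) :
    AsympLE (fun x => (f ⌊x⌋₊ : ℝ)) fun x => (g ⌊x⌋₊ : ℝ) := by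
  obtain ⟨C, hC⟩ := h
  refine ⟨C + 1, by positivity, fun x hx => ?_⟩
  have h1 := Nat.floor_le hx.le
  have h2 : C * ⌊x⌋₊ ≤ ⌊((C + 1 : ℝ) * x + (C + 1))⌋₊ := by
    refine Nat.le_floor ?_
    push_cast
    have : (C : ℝ) * ⌊x⌋₊ ≤ C * x := by gcongr
    linarith [(Nat.cast_nonneg C : (0 : ℝ) ≤ C)]
  have h3 : (f ⌊x⌋₊ : ℝ) ≤ C * g (C * ⌊x⌋₊) + C * ⌊x⌋₊ := by exact_mod_cast hC ⌊x⌋₊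
  have h4 : (g (C * ⌊x⌋₊) : ℝ) ≤ g ⌊((C + 1 : ℝ) * x + (C + 1))⌋₊ := by exact_mod_cast hg h2
  have h5 : (C : ℝ) * g (C * ⌊x⌋₊) ≤ (C + 1) * g ⌊((C + 1 : ℝ) * x + (C + 1))⌋₊ := by
    gcongr
    linarith
  have h6 : (C : ℝ) * ⌊x⌋₊ ≤ C * x := by gcongr
  simp only
  linarith [(Nat.cast_nonneg C : (0 : ℝ) ≤ C)]

/-- The closure is at least `g`, and with the constant `C + 3` the logarithm is taken at a point
above `3 > e`, so it is at least `1`. -/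
theorem AsympLE.superadditiveClosure_mul_log {f : ℝ → ℝ} {g : ℕ → ℝ} (hg0 : g 0 ≤ 0)
    (hg : ∀ n, 0 ≤ g n) (hgm : Monotone g) (h : AsympLE f fun x => g ⌊x⌋₊) :
    AsympLE f fun x => superadditiveClosure g ⌊x⌋₊ * Real.log x := by
  obtain ⟨C, hC, H⟩ := h
  refine ⟨C + 3, by positivity, fun x hx => (H x hx).trans ?_⟩
  have h1 : C * x + C ≤ (C + 3) * x + (C + 3) := by nlinarith
  have h2 : g ⌊C * x + C⌋₊ ≤ superadditiveClosure g ⌊(C + 3) * x + (C + 3)⌋₊ :=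
    (hgm (Nat.floor_mono h1)).trans ((isLeast_superadditiveClosure g hg0).1.2 _)
  have h3 : 1 ≤ Real.log ((C + 3) * x + (C + 3)) := by
    rw [Real.le_log_iff_exp_le (by positivity)]
    have := Real.exp_one_lt_three
    nlinarith
  have h4 : 0 ≤ superadditiveClosure g ⌊(C + 3) * x + (C + 3)⌋₊ := (hg _).trans h2
  have h5 := le_mul_of_one_le_right h4 h3
  have h6 : C * g ⌊C * x + C⌋₊ ≤ (C + 3) * (superadditiveClosure g ⌊(C + 3) * x + (C + 3)⌋₊ *
      Real.log ((C + 3) * x + (C + 3))) :=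
    mul_le_mul (by linarith) (h2.trans h5) (hg _) (by positivity)
  simp only
  linarith

end GroupDehn

/-! ### The theorem -/

open GroupDehn in
theorem mainTheorem8 (G : Fin 4 → Type*) [∀ i, Group (G i)]
    (hG : ∀ i, Group.IsFinitelyPresented (G i))
    (φ : (∀ i, G i) →* Multiplicative (Fin 2 → ℤ))
    (hφ : ∀ i, Function.Surjective (φ.comp (MonoidHom.mulSingle G i))) :
    Group.IsFinitelyPresented φ.ker ∧
    ∀ {α β : Type*} (R : Set (FreeGroup α)) (S : Set (FreeGroup β)),
      GroupDehn.IsFinitePresentationOf R (∀ i, G i) →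
      GroupDehn.IsFinitePresentationOf S φ.ker →
      GroupDehn.AsympLE (fun x => (GroupDehn.dehnFunction R ⌊x⌋₊ : ℝ))
        (fun x => (GroupDehn.dehnFunction S ⌊x⌋₊ : ℝ)) ∧
      GroupDehn.AsympLE (fun x => (GroupDehn.dehnFunction S ⌊x⌋₊ : ℝ))
        (fun x => GroupDehn.superadditiveClosure
          (fun n => (GroupDehn.dehnFunction R n : ℝ)) ⌊x⌋₊ * Real.log x) := by
  choose n hn using fun i => exists_adapted_generators (hG i) _ (hφ i)
  obtain ⟨N, hN⟩ : ∃ N, ∀ i, n i ≤ N := ⟨∑ j, n j, fun i =>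
    Finset.single_le_sum (fun _ _ => Nat.zero_le _) (Finset.mem_univ i)⟩
  choose ψ hψ hψe using fun i => hn i N (hN i)
  choose Q hQ hker using fun i => exists_ker_eq_normalClosure (hG i) (ψ i) (hψ i)
  have hexp : ∀ i, ∀ r ∈ Q i, ∀ s, exponent (Fin N) s r = 1 := by
    intro i r hr s
    have h1 : ψ i r = 1 := by
      rw [← MonoidHom.mem_ker, hker]
      exact Subgroup.subset_normalClosure hr
    have h2 := hψe i r
    rw [h1, map_one] at h2
    exact (congrFun (congrArg Multiplicative.toAdd h2) s).symm
  have hsum : ∀ f : ∀ i, FreeGroup (Fin 2 ⊕ Fin N), φ (fun i => ψ i (f i)) = 1 ↔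
      ∀ s, exponent (Fin N) s (f 0 * f 1 * f 2 * f 3) = 1 := by
    intro f
    rw [map_eq_prod_four, hψe, hψe, hψe, hψe]
    constructor
    · intro h s
      apply Multiplicative.toAdd.injective
      simpa using congrFun (congrArg Multiplicative.toAdd h) s
    · intro h
      apply Multiplicative.toAdd.injective
      funext s
      simpa using congrArg Multiplicative.toAdd (h s)
  -- the presentation of the product
  have hP : IsFinitePresentationOf (prodRelators Q) (∀ i, G i) := by
    refine isFinitePresentationOf_of_ker (finite_prodRelators hQ)
      (MonoidHom.pi fun m => (ψ m).comp (proj _ m)) (fun f => ?_) ?_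
    · choose v hv using fun i => hψ i (f i)
      refine ⟨prodWord v, funext fun m => ?_⟩
      simp [proj_prodWord, hv]
    · ext w
      rw [mem_normalClosure_prodRelators, MonoidHom.mem_ker, funext_iff]
      refine forall_congr' fun m => ?_
      rw [← hker, MonoidHom.mem_ker]
      rfl
  -- the presentation of the kernel
  have hK : IsFinitePresentationOf (kerRelators Q) φ.ker := by
    let π : FreeGroup (KerGen (Fin N)) →* φ.ker :=
      (MonoidHom.pi fun m => (ψ m).comp (coord _ m)).codRestrict φ.ker fun w => by
        rw [MonoidHom.mem_ker]
        exact (hsum fun m => coord _ m w).2 fun s => by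
          simpa using exponent_coord_prod s w
    refine isFinitePresentationOf_of_ker (finite_kerRelators hQ) π (fun f => ?_) ?_
    -- Normal forms also give generation: lift the components of `f` to free groups and take the
    -- normal form with these coordinates.
    · choose v hv using fun i => hψ i (f.1 i)
      have hf : φ (fun i => ψ i (v i)) = 1 := by
        simp only [hv]
        exact f.2
      refine ⟨normalForm v, Subtype.ext (funext fun m => ?_)⟩
      change ψ m (coord _ m (normalForm v)) = f.1 m
      rw [coord_normalForm ((hsum v).1 hf), hv]
    · ext w
      rw [mem_normalClosure_kerRelators hexp, MonoidHom.mem_ker, Subtype.ext_iff, funext_iff]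
      refine forall_congr' fun m => ?_
      rw [← hker, MonoidHom.mem_ker]
      rfl
  refine ⟨hK.isFinitelyPresented, fun {α β} R S hR hS => ?_⟩
  have := hR.1
  have := hS.1
  have hRm : Monotone (dehnFunction R) := dehnFunction_mono
  have hSm : Monotone (dehnFunction S) := dehnFunction_mono
  have h1 : Dominated (dehnFunction R) (dehnFunction S) :=
    ((dominated_of_mulEquiv hR hP).trans dehnFunction_mono
      (dominated_prodRelators_kerRelators hQ hexp)).trans hSm (dominated_of_mulEquiv hK hS)
  have h2 : Dominated (dehnFunction S) (dehnFunction R) :=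
    ((dominated_of_mulEquiv hS hK).trans dehnFunction_mono
      (dominated_kerRelators_prodRelators hQ hexp)).trans hRm (dominated_of_mulEquiv hP hR)
  refine ⟨h1.asympLE hSm, AsympLE.superadditiveClosure_mul_log ?_ (fun _ => Nat.cast_nonneg _)
    (fun a b hab => by exact_mod_cast hRm hab) (h2.asympLE hRm)⟩
  simp [dehnFunction_zero]
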